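/- All graphs are finite and simple, with vertex set $\{1,\dots,n\}$, where $n$ is the number of vertices. A *bicyclic graph* is a connected graph with $n$ vertices and $n+1$ edges. For a symmetric function $f(x,y)$ and a graph $G$ with vertex degrees $d_1,\dots,d_n$, let $A_f(G)$ be the $n\times n$ matrix whose $(i,j)$ entry is $f(d_i,d_j)$ if $ij$ is an edge and $0$ otherwise, and let $\rho(A_f(G))$ be its spectral radius (the largest absolute value of an eigenvalue). A bicyclic graph $G$ on $n$ vertices is said to have the *second largest* $\rho(A_f(\cdot))$ if there is a bicyclic graph $H$ on $n$ vertices such that $\rho(A_f(G))<\rho(A_f(H))$ and $\rho(A_f(K))\le\rho(A_f(G))$ for every bicyclic graph $K$ on $n$ vertices that is not isomorphic to $H$. Let $G_2$ be the graph on $n\ge 5$ vertices that consists of two triangles with exactly one common vertex $v$ together with $n-5$ further vertices, each adjacent to $v$ only. **Theorem.** In each of the following cases, a graph on $n$ vertices is a bicyclic graph with the second largest $\rho(A_f(\cdot))$ if and only if it is isomorphic to $G_2$: (i) $f(x,y)=x+y$ (first Zagreb index) and $n\ge 10$; (ii) $f(x,y)=(x+y)^2$ (first hyper-Zagreb index)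 and $n\ge 9$; (iii) $f(x,y)=x^2+y^2$ (forgotten index) and $n\ge 8$. -/

import Mathlib

/-- The weighted adjacency matrix `A_f(G)`: the entry at `i, j` is `f (d_i) (d_j)` if `i` and `j`
are adjacent, and `0` otherwise. -/
noncomputable def weightedAdjMatrix {V : Type*} [Fintype V] (f : ℝ → ℝ → ℝ)
    (G : SimpleGraph V) : Matrix V V ℝ :=
  open Classical in
  Matrix.of fun i j => if G.Adj i j then f (G.degree i : ℝ) (G.degree j : ℝ) else 0

/-- The spectral radius `ρ(A_f(G))`, the largest absolute value of an eigenvalue of `A_f(G)`.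
For symmetric `f` the matrix is real symmetric, so that all its eigenvalues are real. -/
noncomputable def weightedSpectralRadius {V : Type*} [Fintype V] [DecidableEq V]
    (f : ℝ → ℝ → ℝ) (G : SimpleGraph V) : ENNReal :=
  spectralRadius ℝ (weightedAdjMatrix f G)

/-- A bicyclic graph: connected, with `m` edges and `n` vertices where `m - n + 1 = 2`. -/
def IsBicyclic {V : Type*} [Fintype V] (G : SimpleGraph V) : Prop :=
  G.Connected ∧ G.edgeSet.ncard = Fintype.card V + 1

/-- `G` is a bicyclic graph on `n` vertices with the second largest `ρ(A_f(·))`: exactly one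
bicyclic graph on `n` vertices (up to isomorphism) has a strictly larger value, and no other
bicyclic graph on `n` vertices has a value exceeding that of `G`. -/
def IsSecondLargestBicyclic (f : ℝ → ℝ → ℝ) {n : ℕ} (G : SimpleGraph (Fin n)) : Prop :=
  IsBicyclic G ∧ ∃ H : SimpleGraph (Fin n), IsBicyclic H ∧
    weightedSpectralRadius f G < weightedSpectralRadius f H ∧
    ∀ K : SimpleGraph (Fin n), IsBicyclic K → ¬ Nonempty (K ≃g H) →
      weightedSpectralRadius f K ≤ weightedSpectralRadius f G

/-- The graph `G₂` on `n ≥ 5` vertices: the two triangles `0, 1, 2` and `0, 3, 4` with the common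
vertex `0` (the graph `B(3,1,3)`), and the `n - 5` further vertices `5, …, n - 1`, each joined to
`0` only. -/
def graphG2 (n : ℕ) : SimpleGraph (Fin n) :=
  SimpleGraph.fromRel fun i j =>
    i.val = 0 ∨ (i.val = 1 ∧ j.val = 2) ∨ (i.val = 3 ∧ j.val = 4)

/-!
Let `G₁` be the star with two adjacent edges added (`graphG1`) and `G₂` the star with two disjoint
edges added. A bicyclic graph with a dominating vertex is isomorphic to one of the two
(`IsBicyclic.iso_of_dominating`), so that the theorem amounts to `ρ(G₂) < ρ(G₁)` and `ρ(K) < ρ(G₂)`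
for all bicyclic graphs `K` without dominating vertex (`isSecondLargestBicyclic_iff_of_bounds`).

The value `c = ρ(G₂)` is explicit: with `p`, `q`, `s` the weights of the edges of `G₂` from the
centre to a leaf, from the centre to a triangle, and away from the centre, a positive eigenvector
shows that `c` is the root beyond `s` of `(x - s) (x² - C) = 4 q² s`, where `C = 4 q² + (n - 5) p²`
(`weightedSpectralRadius_graphG2`). For `G₁`, solving the eigenvalue equations for `c` at all
vertices but the centre gives a vector whose Rayleigh quotient exceeds `c`
(`lt_weightedSpectralRadius_graphG1_of_root`).

For the other graphs the bound comes from traces. If `ρ` is the spectral radius of a nonnegative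
symmetric matrix `A`, then `ρ` is an eigenvalue and `|μ| ≤ ρ` for all eigenvalues `μ`, so that
`∑ μ² (ρ + μ) ≥ 2 ρ³`, that is, `ρ³ ≤ ρ F + 3 T` if `tr A² = 2 F` and `tr A³ = 6 T`
(`Matrix.IsHermitian.spectralRadius_lt_of_trace`). Here `F` is the sum of the squared edge weights
and `T` the sum over the triangles of the products of their edge weights. As `c² > C`, it is enough
that `F` lies sufficiently far below `C`. A bicyclic graph has at most two triangles
(`IsBicyclic.isNClique_three_cases`), which bounds `T`. For `F`, let `D ≤ n - 2` be the maximum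
degree, attained at `v`, and `k = n - D`. The neighbours of `v` have degrees of sum at most `n + 3`,
each at most `k + 2`, and the `k + 1` edges not at `v` have endpoint degrees of sum at most `k + 4`.
For `D` up to about `n / 3` (or `n / 2` for the forgotten index) it is better to bound all edge
weights by the one for two endpoints of degree `D`. What remains are inequalities between
polynomials in `D` and `k`.
-/

/-! ### Spectral radius of nonnegative symmetric matrices -/

section Spectral

variable {V : Type*} [Fintype V] [DecidableEq V] {A : Matrix V V ℝ}

theorem Matrix.IsHermitian.trace_pow_eq_sum (hA : A.IsHermitian) (k : ℕ) :
    (A ^ k).trace = ∑ i, hA.eigenvalues i ^ k := by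
  conv_lhs => rw [hA.spectral_theorem, ← map_pow, Matrix.diagonal_pow]
  rw [Unitary.conjStarAlgAut_apply, Matrix.trace_mul_cycle, Unitary.coe_star_mul_self, one_mul,
    Matrix.trace_diagonal]
  simp

theorem Matrix.IsHermitian.exists_eigenvector (hA : A.IsHermitian) (i : V) :
    ∃ x : V → ℝ, A.mulVec x = hA.eigenvalues i • x ∧ x ≠ 0 := by
  refine ⟨_, hA.mulVec_eigenvectorBasis i, fun h0 => ?_⟩
  apply hA.eigenvectorBasis.orthonormal.ne_zero i
  ext k
  exact congrFun h0 k

/-- The Rayleigh quotient of a vector is at most some eigenvalue. -/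
theorem Matrix.IsHermitian.exists_rayleigh_le [Nonempty V] (hA : A.IsHermitian) (y : V → ℝ) :
    ∃ i, y ⬝ᵥ A.mulVec y ≤ hA.eigenvalues i * (y ⬝ᵥ y) := by
  obtain ⟨i, -, hi⟩ := Finset.exists_max_image Finset.univ hA.eigenvalues Finset.univ_nonempty
  refine ⟨i, ?_⟩
  set U : Matrix V V ℝ := hA.eigenvectorUnitary.1 with hU
  have h1 : A = U * Matrix.diagonal hA.eigenvalues * U.transpose := by
    conv_lhs => rw [hA.spectral_theorem, Unitary.conjStarAlgAut_apply]
    rfl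
  have h2 : U * U.transpose = 1 := Unitary.coe_mul_star_self hA.eigenvectorUnitary
  set z := U.transpose.mulVec y with hz
  have h3 : y ⬝ᵥ A.mulVec y = z ⬝ᵥ (Matrix.diagonal hA.eigenvalues).mulVec z := by
    conv_lhs => rw [h1]
    rw [← Matrix.mulVec_mulVec, ← Matrix.mulVec_mulVec, Matrix.dotProduct_mulVec,
      ← Matrix.mulVec_transpose]
  have h4 : y ⬝ᵥ y = z ⬝ᵥ z := by
    rw [hz, Matrix.dotProduct_mulVec, ← Matrix.mulVec_transpose, Matrix.transpose_transpose,
      Matrix.mulVec_mulVec, h2, Matrix.one_mulVec]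
  rw [h3, h4]
  simp only [dotProduct, Matrix.mulVec_diagonal, Finset.mul_sum]
  refine Finset.sum_le_sum fun j _ => ?_
  nlinarith [hi j (Finset.mem_univ j), mul_self_nonneg (z j)]

theorem Matrix.IsHermitian.ofReal_eigenvalues_le_spectralRadius (hA : A.IsHermitian) (i : V) :
    ENNReal.ofReal (hA.eigenvalues i) ≤ spectralRadius ℝ A := by
  have h : (‖hA.eigenvalues i‖₊ : ENNReal) ≤ spectralRadius ℝ A :=
    le_iSup₂ (f := fun (k : ℝ) (_ : k ∈ spectrum ℝ A) => (‖k‖₊ : ENNReal)) _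
      (hA.eigenvalues_mem_spectrum_real i)
  refine le_trans ?_ h
  rw [← enorm_eq_nnnorm, ← ofReal_norm]
  exact ENNReal.ofReal_le_ofReal (le_abs_self _)

theorem Matrix.IsHermitian.lt_spectralRadius_of_rayleigh (hA : A.IsHermitian) {c : ℝ} (hc : 0 ≤ c)
    {y : V → ℝ} (h : c * (y ⬝ᵥ y) < y ⬝ᵥ A.mulVec y) :
    ENNReal.ofReal c < spectralRadius ℝ A := by
  have hV : Nonempty V := by
    by_contra hV
    rw [not_nonempty_iff] at hV
    simp [dotProduct] at h
  obtain ⟨i, hi⟩ := hA.exists_rayleigh_le y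
  have h0 : 0 ≤ y ⬝ᵥ y := Finset.sum_nonneg fun j _ => mul_self_nonneg _
  have : c < hA.eigenvalues i := by
    by_contra! hlt
    nlinarith
  exact lt_of_lt_of_le ((ENNReal.ofReal_lt_ofReal_iff (hc.trans_lt this)).2 this)
    (hA.ofReal_eigenvalues_le_spectralRadius i)

/-- The spectral radius of a nonnegative symmetric matrix is its largest eigenvalue. -/
theorem Matrix.IsHermitian.exists_eigenvalue_max [Nonempty V] (hA : A.IsHermitian)
    (hpos : ∀ i j, 0 ≤ A i j) :
    ∃ i, (∀ j, |hA.eigenvalues j| ≤ hA.eigenvalues i) ∧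
      spectralRadius ℝ A = ENNReal.ofReal (hA.eigenvalues i) := by
  obtain ⟨i, -, hi⟩ := Finset.exists_max_image Finset.univ hA.eigenvalues Finset.univ_nonempty
  have habs : ∀ j, |hA.eigenvalues j| ≤ hA.eigenvalues i := by
    intro j
    obtain ⟨x, hx, hx0⟩ := hA.exists_eigenvector j
    -- Passing from an eigenvector to its absolute value does not decrease the quadratic form.
    obtain ⟨l, hl⟩ := hA.exists_rayleigh_le (fun k => |x k|)
    have h1 : |hA.eigenvalues j| * (x ⬝ᵥ x) ≤ (fun k => |x k|) ⬝ᵥ A.mulVec (fun k => |x k|) := by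
      have h2 : |hA.eigenvalues j| * (x ⬝ᵥ x) = |x ⬝ᵥ A.mulVec x| := by
        rw [hx, dotProduct_smul, smul_eq_mul, abs_mul, abs_of_nonneg (a := x ⬝ᵥ x)]
        exact Finset.sum_nonneg fun j _ => mul_self_nonneg _
      rw [h2]
      simp only [dotProduct, Matrix.mulVec, Finset.mul_sum]
      refine (Finset.abs_sum_le_sum_abs _ _).trans (Finset.sum_le_sum fun a _ => ?_)
      refine (Finset.abs_sum_le_sum_abs _ _).trans (Finset.sum_le_sum fun b _ => ?_)
      rw [abs_mul, abs_mul, abs_of_nonneg (hpos a b)]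
    have h3 : (fun k => |x k|) ⬝ᵥ (fun k => |x k|) = x ⬝ᵥ x := by
      simp [dotProduct]
    rw [h3] at hl
    have h4 : 0 < x ⬝ᵥ x := by
      refine lt_of_le_of_ne (Finset.sum_nonneg fun j _ => mul_self_nonneg _) fun h => hx0 ?_
      exact dotProduct_self_eq_zero.1 h.symm
    exact (le_of_mul_le_mul_right (h1.trans hl) h4).trans (hi l (Finset.mem_univ l))
  refine ⟨i, habs, le_antisymm ?_ (hA.ofReal_eigenvalues_le_spectralRadius i)⟩
  refine iSup₂_le fun k hk => ?_
  rw [hA.spectrum_real_eq_range_eigenvalues] at hk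
  obtain ⟨j, rfl⟩ := hk
  rw [← enorm_eq_nnnorm, ← ofReal_norm]
  exact ENNReal.ofReal_le_ofReal (habs j)

/-- A trace bound for the spectral radius. If all eigenvalues `μ` satisfy `|μ| ≤ ρ` and `ρ` is one
of them, then `∑ μ ^ 2 * (ρ + μ) ≥ 2 * ρ ^ 3`, that is, `2 ρ ^ 3 ≤ ρ tr A ^ 2 + tr A ^ 3`. -/
theorem Matrix.IsHermitian.spectralRadius_lt_of_trace [Nonempty V] (hA : A.IsHermitian)
    (hpos : ∀ i j, 0 ≤ A i j) {F T c : ℝ} (hc : 0 < c) (hT : 0 ≤ T)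
    (hF2 : (A ^ 2).trace ≤ 2 * F) (hT3 : (A ^ 3).trace ≤ 6 * T) (h : 3 * T < c * (c ^ 2 - F)) :
    spectralRadius ℝ A < ENNReal.ofReal c := by
  obtain ⟨i, hi, hr⟩ := hA.exists_eigenvalue_max hpos
  rw [hr, ENNReal.ofReal_lt_ofReal_iff hc]
  set r := hA.eigenvalues i with hrdef
  by_contra! hcr
  rw [hA.trace_pow_eq_sum] at hF2 hT3
  have h1 : r ^ 2 * (r + r) ≤ ∑ j, hA.eigenvalues j ^ 2 * (r + hA.eigenvalues j) :=
    Finset.single_le_sum (f := fun j => hA.eigenvalues j ^ 2 * (r + hA.eigenvalues j))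
      (fun j _ => mul_nonneg (sq_nonneg _) (by linarith [neg_abs_le (hA.eigenvalues j), hi j]))
      (Finset.mem_univ i)
  have h2 : ∑ j, hA.eigenvalues j ^ 2 * (r + hA.eigenvalues j)
      = r * ∑ j, hA.eigenvalues j ^ 2 + ∑ j, hA.eigenvalues j ^ 3 := by
    rw [Finset.mul_sum, ← Finset.sum_add_distrib]
    exact Finset.sum_congr rfl fun j _ => by ring
  have hr0 : 0 < r := hc.trans_le hcr
  have h3 : r * ∑ j, hA.eigenvalues j ^ 2 ≤ r * (2 * F) := mul_le_mul_of_nonneg_left hF2 hr0.le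
  have h4 : 0 < c ^ 2 - F := pos_of_mul_pos_right (by linarith : 0 < c * (c ^ 2 - F)) hc.le
  have h5 : c * (c ^ 2 - F) ≤ r * (r ^ 2 - F) :=
    mul_le_mul hcr (by nlinarith) h4.le hr0.le
  nlinarith

/-- A nonnegative symmetric matrix with a positive eigenvector has the corresponding eigenvalue as
its spectral radius. -/
theorem Matrix.IsHermitian.spectralRadius_eq_of_pos_eigenvector [Nonempty V] (hA : A.IsHermitian)
    (hpos : ∀ i j, 0 ≤ A i j) {c : ℝ} {x : V → ℝ} (hx : ∀ i, 0 < x i)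
    (h : A.mulVec x = c • x) : spectralRadius ℝ A = ENNReal.ofReal c := by
  obtain ⟨i, hi, hr⟩ := hA.exists_eigenvalue_max hpos
  rw [hr]
  congr 1
  obtain ⟨y, hy, hy0⟩ := hA.exists_eigenvector i
  have hxx : 0 < x ⬝ᵥ x :=
    Finset.sum_pos (fun j _ => mul_pos (hx j) (hx j)) Finset.univ_nonempty
  apply le_antisymm
  · -- Pair `x` with the absolute value of `y` and use the symmetry of `A`.
    set z : V → ℝ := fun k => |y k| with hz
    have h1 : 0 < x ⬝ᵥ z := by
      obtain ⟨k, hk⟩ := Function.ne_iff.1 hy0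
      exact Finset.sum_pos' (fun j _ => mul_nonneg (hx j).le (abs_nonneg _))
        ⟨k, Finset.mem_univ k, mul_pos (hx k) (abs_pos.2 hk)⟩
    have h2 : hA.eigenvalues i * (x ⬝ᵥ z) ≤ x ⬝ᵥ A.mulVec z := by
      simp only [dotProduct, Finset.mul_sum]
      refine Finset.sum_le_sum fun k _ => ?_
      rw [mul_left_comm]
      refine mul_le_mul_of_nonneg_left ?_ (hx k).le
      have h3 := congrFun hy k
      simp only [Pi.smul_apply, smul_eq_mul] at h3
      calc hA.eigenvalues i * |y k| ≤ |hA.eigenvalues i * y k| := by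
            rw [abs_mul]
            exact mul_le_mul_of_nonneg_right (le_abs_self _) (abs_nonneg _)
        _ = |∑ l, A k l * y l| := by rw [← h3]; rfl
        _ ≤ ∑ l, A k l * |y l| := by
            refine (Finset.abs_sum_le_sum_abs _ _).trans (Finset.sum_le_sum fun l _ => ?_)
            rw [abs_mul, abs_of_nonneg (hpos k l)]
    have h3 : x ⬝ᵥ A.mulVec z = c * (x ⬝ᵥ z) := by
      have hT : A.transpose = A := hA
      rw [Matrix.dotProduct_mulVec, ← Matrix.mulVec_transpose, hT, h, smul_dotProduct, smul_eq_mul]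
    exact le_of_mul_le_mul_right (h2.trans h3.le) h1
  · obtain ⟨j, hj⟩ := hA.exists_rayleigh_le x
    rw [h, dotProduct_smul, smul_eq_mul] at hj
    exact (le_of_mul_le_mul_right hj hxx).trans ((le_abs_self _).trans (hi j))

end Spectral

/-! ### Triangles of bicyclic graphs -/

section Triangles

namespace SimpleGraph

variable {V : Type*} {G : SimpleGraph V}

/-- Deleting an edge of a triangle keeps a graph connected. -/
theorem Connected.deleteEdges_of_isNClique [Finite V] (hG : G.Connected) {t : Finset V}
    (ht : G.IsNClique 3 t) {x y : V} (hx : x ∈ t) (hy : y ∈ t) (hxy : x ≠ y) :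
    (G.deleteEdges {s(x, y)}).Connected ∧
      (G.deleteEdges {s(x, y)}).edgeSet.ncard + 1 = G.edgeSet.ncard := by
  classical
  have hadj : G.Adj x y := ht.isClique hx hy hxy
  constructor
  · apply hG.connected_delete_edge_of_not_isBridge
    rw [isBridge_iff, not_not]
    obtain ⟨z, hz, hzx⟩ : ∃ z ∈ t \ {x}, z ≠ y := by
      refine Finset.exists_mem_ne ?_ y
      rw [Finset.card_sdiff_of_subset (by simpa using hx), ht.card_eq]
      simp
    simp only [Finset.mem_sdiff, Finset.mem_singleton] at hz
    have h1 : (G.deleteEdges {s(x, y)}).Adj x z := by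
      rw [deleteEdges_adj]
      exact ⟨ht.isClique hx hz.1 (Ne.symm hz.2), by simp [hzx, hxy]⟩
    have h2 : (G.deleteEdges {s(x, y)}).Adj z y := by
      rw [deleteEdges_adj]
      exact ⟨ht.isClique hz.1 hy hzx, by simp [hzx, hz.2]⟩
    exact h1.reachable.trans h2.reachable
  · rw [edgeSet_deleteEdges]
    exact Set.ncard_sdiff_singleton_add_one (G.mem_edgeSet.2 hadj) (Set.toFinite _)

theorem IsNClique.deleteEdges_of_notMem {k : ℕ} {t : Finset V} (ht : G.IsNClique k t) {x y : V}
    (h : ¬ (x ∈ t ∧ y ∈ t)) : (G.deleteEdges {s(x, y)}).IsNClique k t := by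
  refine ⟨fun a ha b hb hab => ?_, ht.card_eq⟩
  rw [deleteEdges_adj]
  refine ⟨ht.isClique ha hb hab, ?_⟩
  rw [Set.mem_singleton_iff, Sym2.eq_iff]
  rintro (⟨rfl, rfl⟩ | ⟨rfl, rfl⟩)
  · exact h ⟨ha, hb⟩
  · exact h ⟨hb, ha⟩

theorem IsNClique.exists_mem_notMem {k : ℕ} {s t : Finset V} (hs : G.IsNClique k s)
    (ht : G.IsNClique k t) (h : s ≠ t) : ∃ x ∈ s, x ∉ t := by
  by_contra! hst
  exact h (Finset.eq_of_subset_of_card_le hst (by rw [hs.card_eq, ht.card_eq]))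

/-- A connected graph with as many edges as vertices has at most one triangle. -/
theorem Connected.isNClique_three_unique [Fintype V] (hG : G.Connected)
    (hcard : G.edgeSet.ncard = Fintype.card V) {s t : Finset V} (hs : G.IsNClique 3 s)
    (ht : G.IsNClique 3 t) : s = t := by
  by_contra hne
  obtain ⟨x, hxs, hxt⟩ := hs.exists_mem_notMem ht hne
  obtain ⟨y, hys, hyx⟩ := Finset.exists_mem_ne (by rw [hs.card_eq]; norm_num) x
  obtain ⟨h1, h2⟩ := hG.deleteEdges_of_isNClique hs hxs hys hyx.symm
  -- Without the edge `s(x, y)` the graph is a tree that still contains the triangle `t`.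
  have htree : (G.deleteEdges {s(x, y)}).IsTree := by
    rw [isTree_iff_connected_and_card]
    refine ⟨h1, ?_⟩
    rw [Nat.card_coe_set_eq, h2, hcard, Nat.card_eq_fintype_card]
  exact htree.isAcyclic.cliqueFree le_rfl t (ht.deleteEdges_of_notMem fun h => hxt h.1)

end SimpleGraph

open SimpleGraph

variable {V : Type*} [Fintype V] {G : SimpleGraph V}

/-- A bicyclic graph has at most two triangles. -/
theorem IsBicyclic.isNClique_three_cases (hG : IsBicyclic G) {r s t : Finset V}
    (hr : G.IsNClique 3 r) (hs : G.IsNClique 3 s) (ht : G.IsNClique 3 t) :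
    r = s ∨ r = t ∨ s = t := by
  by_contra! hne
  obtain ⟨h1, h2, h3⟩ := hne
  obtain ⟨x, hxr, hxs⟩ := hr.exists_mem_notMem hs h1
  obtain ⟨y, hyr, hyt⟩ := hr.exists_mem_notMem ht h2
  -- Some edge of `r` contains both `x` and `y`, so that it lies neither in `s` nor in `t`.
  obtain ⟨z, w, hz, hw, hzw, hs', ht'⟩ : ∃ z w, z ∈ r ∧ w ∈ r ∧ z ≠ w ∧
      ¬ (z ∈ s ∧ w ∈ s) ∧ ¬ (z ∈ t ∧ w ∈ t) := by
    by_cases hxy : x = y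
    · obtain ⟨w, hw, hwx⟩ := Finset.exists_mem_ne (by rw [hr.card_eq]; norm_num) x
      exact ⟨x, w, hxr, hw, hwx.symm, fun h => hxs h.1, fun h => hyt (hxy ▸ h.1)⟩
    · exact ⟨x, y, hxr, hyr, hxy, fun h => hxs h.1, fun h => hyt h.2⟩
  obtain ⟨h4, h5⟩ := hG.1.deleteEdges_of_isNClique hr hz hw hzw
  rw [hG.2, add_left_inj] at h5
  exact h3 (h4.isNClique_three_unique h5 (hs.deleteEdges_of_notMem hs')
    (ht.deleteEdges_of_notMem ht'))

open Classical in
/-- A bicyclic graph has at most twelve ordered triangles. -/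
theorem IsBicyclic.card_ordered_triangles_le (hG : IsBicyclic G) :
    (Finset.univ.filter fun p : V × V × V =>
      G.Adj p.1 p.2.1 ∧ G.Adj p.2.1 p.2.2 ∧ G.Adj p.2.2 p.1).card ≤ 12 := by
  set S := Finset.univ.filter fun p : V × V × V =>
      G.Adj p.1 p.2.1 ∧ G.Adj p.2.1 p.2.2 ∧ G.Adj p.2.2 p.1 with hS
  have himage : (S.image fun p => ({p.1, p.2.1, p.2.2} : Finset V)).card ≤ 2 := by
    have hcl : ∀ u ∈ S.image fun p => ({p.1, p.2.1, p.2.2} : Finset V), G.IsNClique 3 u := by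
      intro u hu
      obtain ⟨⟨a, b, c⟩, hp, rfl⟩ := Finset.mem_image.1 hu
      simp only [hS, Finset.mem_filter, Finset.mem_univ, true_and] at hp
      exact is3Clique_triple_iff.2 ⟨hp.1, hp.2.2.symm, hp.2.1⟩
    by_contra! hlt
    obtain ⟨r, s, t, hr, hs, ht, h1, h2, h3⟩ := Finset.two_lt_card_iff.1 hlt
    rcases hG.isNClique_three_cases (hcl r hr) (hcl s hs) (hcl t ht) with h | h | h
    exacts [h1 h, h2 h, h3 h]
  have hfiber : ∀ u ∈ S.image fun p => ({p.1, p.2.1, p.2.2} : Finset V),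
      (S.filter fun p => ({p.1, p.2.1, p.2.2} : Finset V) = u).card ≤ 6 := by
    intro u hu
    obtain ⟨⟨a, b, c⟩, hp, rfl⟩ := Finset.mem_image.1 hu
    refine le_trans (Finset.card_le_card ?_) (Finset.card_le_six (a := (a, b, c))
      (b := (a, c, b)) (c := (b, a, c)) (d := (b, c, a)) (e := (c, a, b)) (f := (c, b, a)))
    rintro ⟨x, y, z⟩ hxyz
    simp only [hS, Finset.mem_filter, Finset.mem_univ, true_and] at hp hxyz
    obtain ⟨⟨h1, h2, h3⟩, h4⟩ := hxyz
    have hx : x ∈ ({a, b, c} : Finset V) := h4 ▸ by simp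
    have hy : y ∈ ({a, b, c} : Finset V) := h4 ▸ by simp
    have hz : z ∈ ({a, b, c} : Finset V) := h4 ▸ by simp
    simp only [Finset.mem_insert, Finset.mem_singleton] at hx hy hz
    have h1' := h1.ne
    have h2' := h2.ne
    have h3' := h3.ne
    clear h4 hu hp h1 h2 h3 himage hS S
    rcases hx with rfl | rfl | rfl <;> rcases hy with rfl | rfl | rfl <;>
      first
      | exact absurd rfl h1'
      | rcases hz with rfl | rfl | rfl <;>
          first
          | exact absurd rfl h2'
          | exact absurd rfl h3'
          | simp
  exact (Finset.card_le_mul_card_image S 6 hfiber).trans (Nat.mul_le_mul_left 6 himage)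

end Triangles

/-! ### Degrees of bicyclic graphs and trace bounds -/

section DegreeBounds

open SimpleGraph

variable {V : Type*} [Fintype V] {G : SimpleGraph V} [DecidableRel G.Adj]

theorem IsBicyclic.card_edgeFinset (hG : IsBicyclic G) :
    G.edgeFinset.card = Fintype.card V + 1 := by
  rw [← hG.2, Set.ncard_eq_toFinset_card', SimpleGraph.edgeFinset]

theorem IsBicyclic.sum_degree (hG : IsBicyclic G) :
    ∑ v, G.degree v = 2 * (Fintype.card V + 1) := by
  rw [G.sum_degrees_eq_twice_card_edges, hG.card_edgeFinset]

omit [DecidableRel G.Adj] in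
theorem IsBicyclic.nontrivial (hG : IsBicyclic G) : Nontrivial V := by
  by_contra h
  rw [not_nontrivial_iff_subsingleton] at h
  have := hG.2
  rw [Subsingleton.elim G ⊥] at this
  simp at this

theorem IsBicyclic.one_le_degree (hG : IsBicyclic G) (v : V) : 1 ≤ G.degree v :=
  have := hG.nontrivial
  hG.1.preconnected.degree_pos_of_nontrivial v

theorem IsBicyclic.sum_degree_neighborFinset_le (hG : IsBicyclic G) (v : V) :
    ∑ j ∈ G.neighborFinset v, G.degree j ≤ Fintype.card V + 3 := by
  classical
  have h1 : ∑ j ∈ insert v (G.neighborFinset v), G.degree j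
      + ∑ j ∈ (insert v (G.neighborFinset v))ᶜ, G.degree j = 2 * (Fintype.card V + 1) := by
    rw [Finset.sum_add_sum_compl, hG.sum_degree]
  have h2 : (insert v (G.neighborFinset v))ᶜ.card • 1
      ≤ ∑ j ∈ (insert v (G.neighborFinset v))ᶜ, G.degree j :=
    Finset.card_nsmul_le_sum _ _ _ fun j _ => hG.one_le_degree j
  rw [Finset.card_compl, Finset.card_insert_of_notMem (by simp), card_neighborFinset_eq_degree,
    smul_eq_mul] at h2
  rw [Finset.sum_insert (by simp)] at h1
  have := G.degree_lt_card_verts v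
  omega

theorem SimpleGraph.card_incidenceFinset_inter_le [DecidableEq V] {u v : V} (huv : u ≠ v) :
    (G.incidenceFinset u ∩ G.incidenceFinset v).card ≤ 1 := by
  refine (Finset.card_le_card (t := {s(u, v)}) fun e he => ?_).trans (Finset.card_singleton _).le
  rw [Finset.mem_inter, mem_incidenceFinset, mem_incidenceFinset] at he
  rw [Finset.mem_singleton]
  exact (Sym2.mem_and_mem_iff huv).1 ⟨he.1.2, he.2.2⟩

theorem IsBicyclic.degree_add_degree_le (hG : IsBicyclic G) {u v : V} (huv : u ≠ v) :
    G.degree u + G.degree v ≤ Fintype.card V + 2 := by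
  classical
  have h1 := Finset.card_union_add_card_inter (G.incidenceFinset u) (G.incidenceFinset v)
  have h2 : (G.incidenceFinset u ∪ G.incidenceFinset v).card ≤ G.edgeFinset.card :=
    Finset.card_le_card (Finset.union_subset (G.incidenceFinset_subset u)
      (G.incidenceFinset_subset v))
  have h3 := G.card_incidenceFinset_inter_le huv
  rw [hG.card_edgeFinset] at h2
  simp only [card_incidenceFinset_eq_degree] at h1
  omega

theorem IsBicyclic.degree_add_degree_add_degree_le (hG : IsBicyclic G) {u v w : V} (huv : u ≠ v)
    (huw : u ≠ w) (hvw : v ≠ w) :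
    G.degree u + G.degree v + G.degree w ≤ Fintype.card V + 4 := by
  classical
  have h1 := Finset.card_union_add_card_inter (G.incidenceFinset u) (G.incidenceFinset v)
  have h2 := Finset.card_union_add_card_inter (G.incidenceFinset u ∪ G.incidenceFinset v)
    (G.incidenceFinset w)
  have h3 : (G.incidenceFinset u ∪ G.incidenceFinset v ∪ G.incidenceFinset w).card
      ≤ G.edgeFinset.card :=
    Finset.card_le_card (Finset.union_subset (Finset.union_subset (G.incidenceFinset_subset u)
      (G.incidenceFinset_subset v)) (G.incidenceFinset_subset w))
  have h4 : ((G.incidenceFinset u ∪ G.incidenceFinset v) ∩ G.incidenceFinset w).card ≤ 1 + 1 := by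
    rw [Finset.union_inter_distrib_right]
    exact (Finset.card_union_le _ _).trans (add_le_add (G.card_incidenceFinset_inter_le huw)
      (G.card_incidenceFinset_inter_le hvw))
  have h5 := G.card_incidenceFinset_inter_le huv
  rw [hG.card_edgeFinset] at h3
  simp only [card_incidenceFinset_eq_degree] at h1 h2
  omega

end DegreeBounds

section Traces

open scoped Classical

variable {V : Type*} [Fintype V] {G : SimpleGraph V} {f : ℝ → ℝ → ℝ}

theorem weightedAdjMatrix_apply (f : ℝ → ℝ → ℝ) (G : SimpleGraph V) (i j : V) :
    weightedAdjMatrix f G i j = if G.Adj i j then f (G.degree i) (G.degree j) else 0 := rfl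

theorem isHermitian_weightedAdjMatrix (hf : ∀ x y, f x y = f y x) (G : SimpleGraph V) :
    (weightedAdjMatrix f G).IsHermitian := by
  ext i j
  simp only [Matrix.conjTranspose_apply, weightedAdjMatrix_apply, star_trivial, G.adj_comm j i,
    hf (G.degree j) (G.degree i)]

theorem weightedAdjMatrix_nonneg (hf : ∀ x y, 0 ≤ x → 0 ≤ y → 0 ≤ f x y) (G : SimpleGraph V)
    (i j : V) : 0 ≤ weightedAdjMatrix f G i j := by
  rw [weightedAdjMatrix_apply]
  split_ifs
  exacts [hf _ _ (Nat.cast_nonneg _) (Nat.cast_nonneg _), le_rfl]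

theorem trace_weightedAdjMatrix_sq [DecidableEq V] (hf : ∀ x y, f x y = f y x) (G : SimpleGraph V) :
    (weightedAdjMatrix f G ^ 2).trace = ∑ i, ∑ j, weightedAdjMatrix f G i j ^ 2 := by
  rw [sq, Matrix.trace]
  refine Finset.sum_congr rfl fun i _ => ?_
  rw [Matrix.diag_apply, Matrix.mul_apply]
  refine Finset.sum_congr rfl fun j _ => ?_
  rw [sq, show weightedAdjMatrix f G j i = weightedAdjMatrix f G i j from
    (isHermitian_weightedAdjMatrix hf G).apply i j]

theorem IsBicyclic.sum_adj (hG : IsBicyclic G) (c : ℝ) :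
    ∑ i, ∑ j, (if G.Adj i j then c else 0) = 2 * (Fintype.card V + 1) * c := by
  have h1 : ∀ i, ∑ j, (if G.Adj i j then c else 0) = G.degree i * c := by
    intro i
    rw [← Finset.sum_filter, Finset.sum_const, nsmul_eq_mul, ← G.neighborFinset_eq_filter,
      G.card_neighborFinset_eq_degree]
  simp only [h1]
  rw [← Finset.sum_mul, ← Nat.cast_sum, hG.sum_degree]
  push_cast
  ring

/-- The `n + 1` edges split into the `D` edges at `v` and the `k + 1` other ones. -/
theorem IsBicyclic.trace_weightedAdjMatrix_sq_le [DecidableEq V] (hG : IsBicyclic G)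
    (hf : ∀ x y, f x y = f y x)
    {v : V} {D k : ℕ} (hD : G.degree v = D) (hk : Fintype.card V = D + k) {p σ ψ : ℝ}
    (hσ : 0 ≤ σ)
    (h1 : ∀ d : ℕ, 1 ≤ d → d ≤ k + 2 → f D d ^ 2 ≤ p + (d - 1) * σ)
    (h2 : ∀ a b : ℕ, 1 ≤ a → 1 ≤ b → a + b ≤ k + 4 → f a b ^ 2 ≤ ψ) :
    (weightedAdjMatrix f G ^ 2).trace ≤ 2 * (D * p + (k + 3) * σ + (k + 1) * ψ) := by
  set A := weightedAdjMatrix f G with hA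
  have hsymm : ∀ i j, A i j = A j i := fun i j => (isHermitian_weightedAdjMatrix hf G).apply j i
  set g : V → ℝ := fun j => A v j ^ 2 - if G.Adj v j then ψ else 0 with hg
  have hpt : ∀ i j, A i j ^ 2 ≤
      (if G.Adj i j then ψ else 0) + ((if i = v then g j else 0) + if j = v then g i else 0) := by
    intro i j
    by_cases hadj : G.Adj i j
    · by_cases hi : i = v
      · subst hi
        simp [hg, hadj, hadj.ne']
      · by_cases hj : j = v
        · subst hj
          simp [hg, hadj, hadj.symm, hi, hsymm i j]
        · have := hG.degree_add_degree_add_degree_le (Ne.symm hi) (Ne.symm hj) hadj.ne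
          simp only [hadj, if_true, hi, hj, if_false, add_zero]
          rw [hA, weightedAdjMatrix_apply, if_pos hadj]
          exact h2 _ _ (hG.one_le_degree i) (hG.one_le_degree j) (by omega)
    · have h0 : A i j = 0 := by rw [hA, weightedAdjMatrix_apply, if_neg hadj]
      rw [h0, if_neg hadj]
      by_cases hi : i = v
      · subst hi
        by_cases hj : j = i
        · subst hj; simp [hg, hA, weightedAdjMatrix_apply]
        · simp [hg, h0, hadj, hj]
      · by_cases hj : j = v
        · subst hj
          have h0' : A j i = 0 := by rw [hsymm, h0]
          simp [hg, G.adj_comm j i, hadj, h0', hi]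
        · simp [hi, hj]
  have hrow : ∑ j, A v j ^ 2 ≤ D * p + (k + 3) * σ := by
    have e1 : ∑ j, A v j ^ 2 = ∑ j ∈ G.neighborFinset v, f D (G.degree j) ^ 2 := by
      rw [G.neighborFinset_eq_filter, Finset.sum_filter]
      refine Finset.sum_congr rfl fun j _ => ?_
      rw [hA, weightedAdjMatrix_apply, hD]
      split_ifs <;> simp
    have e2 : ∑ j ∈ G.neighborFinset v, f D (G.degree j) ^ 2
        ≤ ∑ j ∈ G.neighborFinset v, (p + ((G.degree j : ℝ) - 1) * σ) := by
      refine Finset.sum_le_sum fun j hj => h1 _ (hG.one_le_degree j) ?_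
      have := hG.degree_add_degree_le ((G.mem_neighborFinset v j).1 hj).ne
      omega
    have e3 : ∑ j ∈ G.neighborFinset v, ((G.degree j : ℝ) - 1) ≤ k + 3 := by
      have := hG.sum_degree_neighborFinset_le v
      rw [hk] at this
      rw [Finset.sum_sub_distrib, Finset.sum_const, G.card_neighborFinset_eq_degree, hD]
      have h : ((∑ j ∈ G.neighborFinset v, G.degree j : ℕ) : ℝ) ≤ ((D + k + 3 : ℕ) : ℝ) :=
        Nat.cast_le.2 this
      push_cast at h
      rw [nsmul_eq_mul, mul_one]
      linarith
    rw [e1]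
    refine e2.trans ?_
    rw [Finset.sum_add_distrib, Finset.sum_const, G.card_neighborFinset_eq_degree, hD,
      ← Finset.sum_mul, nsmul_eq_mul]
    exact add_le_add le_rfl (mul_le_mul_of_nonneg_right e3 hσ)
  have hgsum : ∑ j, g j = ∑ j, A v j ^ 2 - D * ψ := by
    rw [hg, Finset.sum_sub_distrib, ← Finset.sum_filter, Finset.sum_const, nsmul_eq_mul,
      ← G.neighborFinset_eq_filter, G.card_neighborFinset_eq_degree, hD]
  rw [trace_weightedAdjMatrix_sq hf]
  refine (Finset.sum_le_sum fun i _ => Finset.sum_le_sum fun j _ => hpt i j).trans ?_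
  simp only [Finset.sum_add_distrib]
  rw [hG.sum_adj]
  have e4 : ∑ i, ∑ j, (if i = v then g j else 0) = ∑ j, g j := by
    rw [Finset.sum_comm]; simp
  have e5 : ∑ i, ∑ j, (if j = v then g i else 0) = ∑ j, g j := by simp
  rw [e4, e5, hgsum, hk]
  push_cast
  linarith

theorem IsBicyclic.trace_weightedAdjMatrix_cube_le [DecidableEq V] (hG : IsBicyclic G) {τ : ℝ}
    (hτ : 0 ≤ τ)
    (h : ∀ i j l, G.Adj i j → G.Adj j l → G.Adj l i → f (G.degree i) (G.degree j) *
      (f (G.degree j) (G.degree l) * f (G.degree l) (G.degree i)) ≤ τ) :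
    (weightedAdjMatrix f G ^ 3).trace ≤ 12 * τ := by
  have e1 : (weightedAdjMatrix f G ^ 3).trace = ∑ p : V × V × V, weightedAdjMatrix f G p.1 p.2.1 *
      (weightedAdjMatrix f G p.2.1 p.2.2 * weightedAdjMatrix f G p.2.2 p.1) := by
    rw [pow_succ', sq, Matrix.trace, Fintype.sum_prod_type]
    refine Finset.sum_congr rfl fun i _ => ?_
    rw [Matrix.diag_apply, Matrix.mul_apply, Fintype.sum_prod_type]
    refine Finset.sum_congr rfl fun j _ => ?_
    rw [Matrix.mul_apply, Finset.mul_sum]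
  have e2 : ∀ p : V × V × V, weightedAdjMatrix f G p.1 p.2.1 *
      (weightedAdjMatrix f G p.2.1 p.2.2 * weightedAdjMatrix f G p.2.2 p.1) ≤
      if G.Adj p.1 p.2.1 ∧ G.Adj p.2.1 p.2.2 ∧ G.Adj p.2.2 p.1 then τ else 0 := by
    rintro ⟨i, j, l⟩
    simp only [weightedAdjMatrix_apply]
    by_cases h1 : G.Adj i j <;> by_cases h2 : G.Adj j l <;> by_cases h3 : G.Adj l i <;>
      simp [h1, h2, h3]
    exact h i j l h1 h2 h3
  rw [e1]
  refine (Finset.sum_le_sum fun p _ => e2 p).trans ?_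
  rw [← Finset.sum_filter, Finset.sum_const, nsmul_eq_mul]
  refine mul_le_mul_of_nonneg_right ?_ hτ
  exact_mod_cast hG.card_ordered_triangles_le

/-- Bound in terms of a vertex of degree `D`, with `k + 1` edges elsewhere: an edge not at that
vertex weighs at most `w`, and two edges of a triangle at that vertex weigh at most `m` together. -/
theorem IsBicyclic.weightedSpectralRadius_lt_of_degree [DecidableEq V] (hG : IsBicyclic G)
    (hf : ∀ x y, f x y = f y x) (hf0 : ∀ x y, 0 ≤ x → 0 ≤ y → 0 ≤ f x y)
    {v : V} {D k : ℕ} (hD : G.degree v = D) (hk : Fintype.card V = D + k) {p σ w m c : ℝ}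
    (hσ : 0 ≤ σ)
    (h1 : ∀ d : ℕ, 1 ≤ d → d ≤ k + 2 → f D d ^ 2 ≤ p + (d - 1) * σ)
    (h2 : ∀ a b : ℕ, 1 ≤ a → 1 ≤ b → a + b ≤ k + 4 → f a b ≤ w)
    (h3 : ∀ a b : ℕ, 1 ≤ a → 1 ≤ b → a ≤ k + 2 → b ≤ k + 2 → a + b ≤ k + 4 →
      f D a * f D b ≤ m)
    (hw : 0 ≤ w) (hwm : w ^ 2 ≤ m) (hc : 0 < c)
    (h : 6 * (m * w) < c * (c ^ 2 - (D * p + (k + 3) * σ + (k + 1) * w ^ 2))) :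
    weightedSpectralRadius f G < ENNReal.ofReal c := by
  have := hG.nontrivial
  have hm : 0 ≤ m := (sq_nonneg w).trans hwm
  have hfn : ∀ a b : ℕ, 0 ≤ f a b := fun a b => hf0 _ _ (Nat.cast_nonneg _) (Nat.cast_nonneg _)
  -- A triangle at `v`, in the order `v`, `j`, `l`.
  have hv : ∀ j l, G.Adj v j → G.Adj j l → G.Adj l v →
      f (G.degree v) (G.degree j) * f (G.degree v) (G.degree l) ≤ m ∧
      f (G.degree j) (G.degree l) ≤ w := by
    intro j l hj hjl hl
    have b1 := hG.degree_add_degree_le hj.ne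
    have b2 := hG.degree_add_degree_le hl.ne'
    have b3 := hG.degree_add_degree_add_degree_le hj.ne hl.ne' hjl.ne
    have b4 := hG.one_le_degree j
    have b5 := hG.one_le_degree l
    rw [hD]
    exact ⟨h3 _ _ b4 b5 (by omega) (by omega) (by omega), h2 _ _ b4 b5 (by omega)⟩
  have hedge : ∀ i j, i ≠ v → j ≠ v → G.Adj i j → f (G.degree i) (G.degree j) ≤ w := by
    intro i j hi hj hij
    have b3 := hG.degree_add_degree_add_degree_le hi.symm hj.symm hij.ne
    exact h2 _ _ (hG.one_le_degree i) (hG.one_le_degree j) (by omega)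
  refine (isHermitian_weightedAdjMatrix hf G).spectralRadius_lt_of_trace
    (weightedAdjMatrix_nonneg hf0 G) hc (T := 2 * (m * w)) (by positivity)
    (hG.trace_weightedAdjMatrix_sq_le hf hD hk (ψ := w ^ 2) hσ h1 fun a b ha hb hab =>
      pow_le_pow_left₀ (hfn a b) (h2 a b ha hb hab) 2)
    ((hG.trace_weightedAdjMatrix_cube_le (τ := m * w) (by positivity) ?_).trans_eq (by ring))
    (by linarith)
  intro i j l hij hjl hli
  have aux : ∀ x y z : ℝ, 0 ≤ z → x * y ≤ m → z ≤ w → x * y * z ≤ m * w := fun x y z hz h1 h2 =>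
    mul_le_mul h1 h2 hz hm
  by_cases hi : i = v
  · subst hi
    obtain ⟨q1, q2⟩ := hv j l hij hjl hli
    rw [hf (G.degree l) (G.degree i)]
    exact le_of_eq_of_le (by ring) (aux _ _ _ (hfn _ _) q1 q2)
  · by_cases hj : j = v
    · subst hj
      obtain ⟨q1, q2⟩ := hv l i hjl hli hij
      rw [hf (G.degree i) (G.degree j)]
      exact le_of_eq_of_le (by ring) (aux _ _ _ (hfn _ _) q1 q2)
    · by_cases hl : l = v
      · subst hl
        obtain ⟨q1, q2⟩ := hv i j hli hij hjl
        rw [hf (G.degree j) (G.degree l)]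
        exact le_of_eq_of_le (by ring) (aux _ _ _ (hfn _ _) q1 q2)
      · have q1 := hedge i j hi hj hij
        have q2 := hedge j l hj hl hjl
        have q3 := hedge l i hl hi hli
        refine le_of_eq_of_le (mul_assoc _ _ _).symm (aux _ _ _ (hfn _ _) ?_ q3)
        exact (mul_le_mul q1 q2 (hfn _ _) hw).trans (by rwa [← sq])

/-- Bound in terms of the largest edge weight `w`. -/
theorem IsBicyclic.weightedSpectralRadius_lt_of_weight [DecidableEq V] (hG : IsBicyclic G)
    (hf : ∀ x y, f x y = f y x) (hf0 : ∀ x y, 0 ≤ x → 0 ≤ y → 0 ≤ f x y) {w c : ℝ}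
    (h1 : ∀ i j, f (G.degree i) (G.degree j) ≤ w) (hw : 0 ≤ w) (hc : 0 < c)
    (h : 6 * w ^ 3 < c * (c ^ 2 - (Fintype.card V + 1) * w ^ 2)) :
    weightedSpectralRadius f G < ENNReal.ofReal c := by
  have := hG.nontrivial
  have hfn : ∀ a b : ℕ, 0 ≤ f a b := fun a b => hf0 _ _ (Nat.cast_nonneg _) (Nat.cast_nonneg _)
  refine (isHermitian_weightedAdjMatrix hf G).spectralRadius_lt_of_trace
    (F := (Fintype.card V + 1) * w ^ 2) (T := 2 * w ^ 3)
    (weightedAdjMatrix_nonneg hf0 G) hc (by positivity) ?_ ?_ (by linarith)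
  · rw [trace_weightedAdjMatrix_sq hf, ← mul_assoc, ← hG.sum_adj]
    refine Finset.sum_le_sum fun i _ => Finset.sum_le_sum fun j _ => ?_
    rw [weightedAdjMatrix_apply]
    split_ifs
    · exact pow_le_pow_left₀ (hfn _ _) (h1 i j) 2
    · simp
  · refine (hG.trace_weightedAdjMatrix_cube_le (τ := w ^ 3) (by positivity)
      fun i j l _ _ _ => ?_).trans_eq (by ring)
    calc _ ≤ w * (w * w) := mul_le_mul (h1 i j) (mul_le_mul (h1 j l) (h1 l i) (hfn _ _) hw)
          (mul_nonneg (hfn _ _) (hfn _ _)) hw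
      _ = w ^ 3 := by ring

end Traces

/-! ### The graphs `G₁` and `G₂` -/

section ExtremalGraphs

open SimpleGraph

/-- The graph on `n ≥ 4` vertices in which `0` is joined to all other vertices and `1` moreover to
`2` and `3`: two triangles with a common edge `0, 1`, and `n - 4` further vertices joined to `0`
only. -/
def graphG1 (n : ℕ) : SimpleGraph (Fin n) :=
  SimpleGraph.fromRel fun i j => i.val = 0 ∨ (i.val = 1 ∧ (j.val = 2 ∨ j.val = 3))

theorem Fin.sum_univ_five_add {M : Type*} [AddCommMonoid M] (m : ℕ) (g : ℕ → M) :
    ∑ j : Fin (5 + m), g j = g 0 + g 1 + g 2 + g 3 + g 4 + ∑ j : Fin m, g (5 + j) := by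
  rw [Fin.sum_univ_add, Fin.sum_univ_five]
  rfl

theorem Fin.sum_univ_four_add {M : Type*} [AddCommMonoid M] (m : ℕ) (g : ℕ → M) :
    ∑ j : Fin (4 + m), g j = g 0 + g 1 + g 2 + g 3 + ∑ j : Fin m, g (4 + j) := by
  rw [Fin.sum_univ_add, Fin.sum_univ_four]
  rfl

theorem graphG2_adj {n : ℕ} {i j : Fin n} : (graphG2 n).Adj i j ↔
    (i : ℕ) ≠ j ∧ ((i : ℕ) = 0 ∨ (j : ℕ) = 0 ∨ ((i : ℕ) = 1 ∧ (j : ℕ) = 2) ∨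
      ((i : ℕ) = 2 ∧ (j : ℕ) = 1) ∨ ((i : ℕ) = 3 ∧ (j : ℕ) = 4) ∨
      ((i : ℕ) = 4 ∧ (j : ℕ) = 3)) := by
  rw [graphG2, fromRel_adj, ne_eq, Fin.ext_iff]
  tauto

theorem graphG1_adj {n : ℕ} {i j : Fin n} : (graphG1 n).Adj i j ↔
    (i : ℕ) ≠ j ∧ ((i : ℕ) = 0 ∨ (j : ℕ) = 0 ∨ ((i : ℕ) = 1 ∧ (j : ℕ) = 2) ∨
      ((i : ℕ) = 2 ∧ (j : ℕ) = 1) ∨ ((i : ℕ) = 1 ∧ (j : ℕ) = 3) ∨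
      ((i : ℕ) = 3 ∧ (j : ℕ) = 1)) := by
  rw [graphG1, fromRel_adj, ne_eq, Fin.ext_iff]
  tauto

theorem sum_graphG2_adj {M : Type*} [AddCommMonoid M] {m : ℕ}
    [DecidableRel (graphG2 (5 + m)).Adj] (i : Fin (5 + m)) (g : ℕ → M) :
    ∑ j, (if (graphG2 (5 + m)).Adj i j then g j else 0) =
      if (i : ℕ) = 0 then g 1 + g 2 + g 3 + g 4 + ∑ j : Fin m, g (5 + j) else
      if (i : ℕ) = 1 then g 0 + g 2 else if (i : ℕ) = 2 then g 0 + g 1 else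
      if (i : ℕ) = 3 then g 0 + g 4 else if (i : ℕ) = 4 then g 0 + g 3 else g 0 := by
  simp only [graphG2_adj]
  rw [Fin.sum_univ_five_add m fun j => if (i : ℕ) ≠ j ∧ ((i : ℕ) = 0 ∨ j = 0 ∨
    ((i : ℕ) = 1 ∧ j = 2) ∨ ((i : ℕ) = 2 ∧ j = 1) ∨ ((i : ℕ) = 3 ∧ j = 4) ∨
    ((i : ℕ) = 4 ∧ j = 3)) then g j else 0]
  have h5 : ∀ j : ℕ, 0 ≠ 5 + j ∧ 5 + j ≠ 0 ∧ 5 + j ≠ 1 ∧ 5 + j ≠ 2 ∧ 5 + j ≠ 3 ∧ 5 + j ≠ 4 := by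
    omega
  obtain ⟨i, hi⟩ := i
  rcases i with _ | _ | _ | _ | _ | i
  all_goals simp [h5]

theorem sum_graphG1_adj {M : Type*} [AddCommMonoid M] {m : ℕ}
    [DecidableRel (graphG1 (4 + m)).Adj] (i : Fin (4 + m)) (g : ℕ → M) :
    ∑ j, (if (graphG1 (4 + m)).Adj i j then g j else 0) =
      if (i : ℕ) = 0 then g 1 + g 2 + g 3 + ∑ j : Fin m, g (4 + j) else
      if (i : ℕ) = 1 then g 0 + g 2 + g 3 else if (i : ℕ) = 2 then g 0 + g 1 else
      if (i : ℕ) = 3 then g 0 + g 1 else g 0 := by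
  simp only [graphG1_adj]
  rw [Fin.sum_univ_four_add m fun j => if (i : ℕ) ≠ j ∧ ((i : ℕ) = 0 ∨ j = 0 ∨
    ((i : ℕ) = 1 ∧ j = 2) ∨ ((i : ℕ) = 2 ∧ j = 1) ∨ ((i : ℕ) = 1 ∧ j = 3) ∨
    ((i : ℕ) = 3 ∧ j = 1)) then g j else 0]
  have h5 : ∀ j : ℕ, 0 ≠ 4 + j ∧ 4 + j ≠ 0 ∧ 4 + j ≠ 1 ∧ 4 + j ≠ 2 ∧ 4 + j ≠ 3 := by
    omega
  obtain ⟨i, hi⟩ := i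
  rcases i with _ | _ | _ | _ | i
  all_goals simp [h5]

open scoped Classical

theorem SimpleGraph.degree_eq_sum_adj {V : Type*} [Fintype V] (G : SimpleGraph V) (i : V) :
    G.degree i = ∑ j, if G.Adj i j then 1 else 0 := by
  rw [← G.card_neighborFinset_eq_degree, G.neighborFinset_eq_filter, Finset.card_filter]

theorem degree_graphG2 (m : ℕ) (i : Fin (5 + m)) :
    (graphG2 (5 + m)).degree i =
      if (i : ℕ) = 0 then 4 + m else if (i : ℕ) < 5 then 2 else 1 := by
  rw [degree_eq_sum_adj, sum_graphG2_adj i fun _ => 1]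
  obtain ⟨i, hi⟩ := i
  rcases i with _ | _ | _ | _ | _ | i
  all_goals simp

theorem degree_graphG1 (m : ℕ) (i : Fin (4 + m)) :
    (graphG1 (4 + m)).degree i =
      if (i : ℕ) = 0 then 3 + m else if (i : ℕ) = 1 then 3 else if (i : ℕ) < 4 then 2 else 1 := by
  rw [degree_eq_sum_adj, sum_graphG1_adj i fun _ => 1]
  obtain ⟨i, hi⟩ := i
  rcases i with _ | _ | _ | _ | i
  all_goals simp

theorem isBicyclic_of_dominating {V : Type*} [Fintype V] {G : SimpleGraph V} {v : V}
    (hv : ∀ w, w ≠ v → G.Adj v w) (hdeg : ∑ w, G.degree w = 2 * (Fintype.card V + 1)) :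
    IsBicyclic G := by
  constructor
  · rw [connected_iff_exists_forall_reachable]
    refine ⟨v, fun w => ?_⟩
    by_cases hw : w = v
    · rw [hw]
    · exact (hv w hw).reachable
  · rw [G.sum_degrees_eq_twice_card_edges] at hdeg
    rw [Set.ncard_eq_toFinset_card', ← SimpleGraph.edgeFinset]
    omega

theorem isBicyclic_graphG2 (m : ℕ) : IsBicyclic (graphG2 (5 + m)) := by
  refine isBicyclic_of_dominating (v := ⟨0, by omega⟩) (fun w hw => ?_) ?_
  · rw [ne_eq, Fin.ext_iff] at hw
    exact graphG2_adj.2 ⟨Ne.symm hw, Or.inl rfl⟩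
  · simp only [degree_graphG2]
    rw [Fin.sum_univ_five_add m fun i => if i = 0 then 4 + m else if i < 5 then 2 else 1]
    simp
    omega

theorem isBicyclic_graphG1 (m : ℕ) : IsBicyclic (graphG1 (4 + m)) := by
  refine isBicyclic_of_dominating (v := ⟨0, by omega⟩) (fun w hw => ?_) ?_
  · rw [ne_eq, Fin.ext_iff] at hw
    exact graphG1_adj.2 ⟨Ne.symm hw, Or.inl rfl⟩
  · simp only [degree_graphG1]
    rw [Fin.sum_univ_four_add m fun i => if i = 0 then 3 + m else if i = 1 then 3 else
      if i < 4 then 2 else 1]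
    have h4 : ∀ j : ℕ, 4 + j ≠ 1 := by omega
    simp [h4]
    omega

theorem weightedSpectralRadius_congr {V W : Type*} [Fintype V] [Fintype W] [DecidableEq V]
    [DecidableEq W] (f : ℝ → ℝ → ℝ) {G : SimpleGraph V} {H : SimpleGraph W} (e : G ≃g H) :
    weightedSpectralRadius f G = weightedSpectralRadius f H := by
  have h : Matrix.reindexAlgEquiv ℝ ℝ e.toEquiv (weightedAdjMatrix f G) =
      weightedAdjMatrix f H := by
    ext i j
    obtain ⟨i, rfl⟩ := e.surjective i
    obtain ⟨j, rfl⟩ := e.surjective j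
    have hs : ∀ x, e.toEquiv.symm (e x) = x := e.toEquiv.symm_apply_apply
    rw [Matrix.coe_reindexAlgEquiv, Matrix.reindex_apply, Matrix.submatrix_apply, hs, hs,
      weightedAdjMatrix_apply, weightedAdjMatrix_apply, e.map_adj_iff, e.degree_eq, e.degree_eq]
  rw [weightedSpectralRadius, weightedSpectralRadius, spectralRadius, spectralRadius, ← h,
    AlgEquiv.spectrum_eq]

/-- The quotient of `A_f(G₂)` by the partition into the centre, the four other triangle vertices
and the leaves has characteristic polynomial `(x - s) * (x ^ 2 - 4 q ^ 2 - m p ^ 2) - 4 q ^ 2 s`,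
and its root beyond `s` has a positive eigenvector. -/
theorem weightedSpectralRadius_graphG2 {f : ℝ → ℝ → ℝ} (hf : ∀ x y, f x y = f y x)
    (hf0 : ∀ x y, 0 ≤ x → 0 ≤ y → 0 ≤ f x y) {m : ℕ} {p q s c : ℝ} (hp : f (4 + m) 1 = p)
    (hq : f (4 + m) 2 = q) (hs : f 2 2 = s) (hp0 : 0 < p) (hq0 : 0 < q) (hs0 : 0 < s) (hsc : s < c)
    (hc : (c - s) * (c ^ 2 - (4 * q ^ 2 + m * p ^ 2)) = 4 * q ^ 2 * s) :
    weightedSpectralRadius f (graphG2 (5 + m)) = ENNReal.ofReal c := by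
  have : Nonempty (Fin (5 + m)) := ⟨⟨0, by omega⟩⟩
  have hc0 : 0 < c := hs0.trans hsc
  have hcs : 0 < c - s := sub_pos.2 hsc
  have hp' : f 1 (4 + m) = p := by rw [hf, hp]
  have hq' : f 2 (4 + m) = q := by rw [hf, hq]
  set x : ℕ → ℝ := fun j => if j = 0 then 1 else if j < 5 then q / (c - s) else p / c with hx
  set d : ℕ → ℝ := fun j => if j = 0 then 4 + m else if j < 5 then 2 else 1 with hd
  have hdeg : ∀ i, ((graphG2 (5 + m)).degree i : ℝ) = d i := by
    intro i
    rw [degree_graphG2, hd]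
    push_cast
    rfl
  have h5 : ∀ j : ℕ, ¬ 5 + j = 0 ∧ ¬ 5 + j < 5 ∧ ¬ j + 1 + 1 + 1 + 1 + 1 < 5 := by omega
  refine (isHermitian_weightedAdjMatrix hf _).spectralRadius_eq_of_pos_eigenvector
    (weightedAdjMatrix_nonneg hf0 _) (x := fun i => x i) (fun i => ?_) ?_
  · simp only [hx]
    split_ifs <;> positivity
  · funext i
    have hrow : (weightedAdjMatrix f (graphG2 (5 + m))).mulVec (fun i => x i) i =
        ∑ j, if (graphG2 (5 + m)).Adj i j then f (d i) (d j) * x j else 0 := by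
      rw [Matrix.mulVec, dotProduct]
      refine Finset.sum_congr rfl fun j _ => ?_
      rw [weightedAdjMatrix_apply, hdeg, hdeg, ite_mul, zero_mul]
    rw [hrow, sum_graphG2_adj i fun j => f (d i) (d j) * x j, Pi.smul_apply, smul_eq_mul]
    obtain ⟨i, hi⟩ := i
    rcases i with _ | _ | _ | _ | _ | i
    all_goals simp [hx, hd, h5, hp, hq, hs, hp', hq']
    all_goals field_simp
    all_goals linarith

/-- The vector used here satisfies the eigenvalue equation for `c` in all coordinates but that of
the centre, where it exceeds it. -/
theorem lt_weightedSpectralRadius_graphG1 {f : ℝ → ℝ → ℝ} (hf : ∀ x y, f x y = f y x)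
    {m : ℕ} {p q r t b d c : ℝ} (hp : f (3 + m) 1 = p)
    (hq : f (3 + m) 2 = q) (hr : f (3 + m) 3 = r) (ht : f 3 2 = t) (hc0 : 0 < c)
    (hb : c * b = r + 2 * t * d) (hd : c * d = q + t * b)
    (hc : c < r * b + 2 * q * d + m * p ^ 2 / c) :
    ENNReal.ofReal c < weightedSpectralRadius f (graphG1 (4 + m)) := by
  have hp' : f 1 (3 + m) = p := by rw [hf, hp]
  have hq' : f 2 (3 + m) = q := by rw [hf, hq]
  have hr' : f 3 (3 + m) = r := by rw [hf, hr]
  have ht' : f 2 3 = t := by rw [hf, ht]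
  set x : ℕ → ℝ := fun j => if j = 0 then 1 else if j = 1 then b else if j < 4 then d else p / c
    with hx
  set e : ℕ → ℝ := fun j => if j = 0 then 3 + m else if j = 1 then 3 else if j < 4 then 2 else 1
    with he
  have hdeg : ∀ i, ((graphG1 (4 + m)).degree i : ℝ) = e i := by
    intro i
    rw [degree_graphG1, he]
    push_cast
    rfl
  have h4 : ∀ j : ℕ, ¬ 4 + j = 0 ∧ ¬ 4 + j = 1 ∧ ¬ 4 + j < 4 ∧ ¬ j + 1 + 1 + 1 + 1 < 4 := by
    omega
  refine (isHermitian_weightedAdjMatrix hf _).lt_spectralRadius_of_rayleigh hc0.le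
    (y := fun i => x i) ?_
  have hrow : ∀ i : Fin (4 + m), (weightedAdjMatrix f (graphG1 (4 + m))).mulVec (fun i => x i) i =
      c * x i + if (i : ℕ) = 0 then r * b + 2 * q * d + m * p ^ 2 / c - c else 0 := by
    intro i
    have hrow' : (weightedAdjMatrix f (graphG1 (4 + m))).mulVec (fun i => x i) i =
        ∑ j, if (graphG1 (4 + m)).Adj i j then f (e i) (e j) * x j else 0 := by
      rw [Matrix.mulVec, dotProduct]
      refine Finset.sum_congr rfl fun j _ => ?_
      rw [weightedAdjMatrix_apply, hdeg, hdeg, ite_mul, zero_mul]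
    rw [hrow', sum_graphG1_adj i fun j => f (e i) (e j) * x j]
    obtain ⟨i, hi⟩ := i
    rcases i with _ | _ | _ | _ | i
    all_goals simp [hx, he, h4, hp, hq, hr, ht, hp', hq', hr', ht']
    · ring
    · linarith
    · linarith
    · linarith
    · field_simp
  simp only [dotProduct, hrow, mul_add, Finset.sum_add_distrib, mul_ite, mul_zero]
  rw [Fin.sum_univ_four_add m fun i => if i = 0 then
    x i * (r * b + 2 * q * d + m * p ^ 2 / c - c) else 0, Finset.mul_sum]
  simp only [mul_left_comm c]
  simp [hx]
  linarith

end ExtremalGraphs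

/-! ### Bicyclic graphs with a dominating vertex -/

section DominatingVertex

open SimpleGraph

open scoped Classical

theorem List.Nodup.exists_perm_apply_eq {n : ℕ} {l : List (Fin n)} (hl : l.Nodup) :
    ∃ σ : Equiv.Perm (Fin n), ∀ i (h : i < l.length) x, (σ x : ℕ) = i ↔ x = l[i] := by
  have := Equiv.Perm.isMultiplyPretransitive (Fin n) l.length
  have hn : l.length ≤ n := by simpa using hl.length_le_card
  obtain ⟨σ, hσ⟩ := MulAction.exists_smul_eq (Equiv.Perm (Fin n))
    (⟨l.get, List.nodup_iff_injective_get.1 hl⟩ : Fin l.length ↪ Fin n) (Fin.castLEEmb hn)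
  refine ⟨σ, fun i h x => ?_⟩
  have h1 : σ l[i] = Fin.castLE hn ⟨i, h⟩ := DFunLike.congr_fun hσ ⟨i, h⟩
  rw [← σ.apply_eq_iff_eq (x := x), h1, Fin.ext_iff, Fin.val_castLE]

theorem IsBicyclic.exists_edges_of_dominating {V : Type*} [Fintype V] {K : SimpleGraph V}
    (hK : IsBicyclic K) {v : V} (hv : K.degree v + 1 = Fintype.card V) :
    ∃ a b c d, a ≠ b ∧ c ≠ d ∧ a ≠ v ∧ b ≠ v ∧ c ≠ v ∧ d ≠ v ∧ s(a, b) ≠ s(c, d) ∧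
      ∀ x y, K.Adj x y ↔ x ≠ y ∧ (x = v ∨ y = v ∨ s(x, y) = s(a, b) ∨ s(x, y) = s(c, d)) := by
  have hcard : (K.edgeFinset \ K.incidenceFinset v).card = 2 := by
    rw [Finset.card_sdiff_of_subset (K.incidenceFinset_subset v), hK.card_edgeFinset,
      K.card_incidenceFinset_eq_degree]
    omega
  obtain ⟨e₁, e₂, hne, he⟩ := Finset.card_eq_two.1 hcard
  have hdom : ∀ w, w ≠ v → K.Adj v w := by
    intro w hw
    have h1 : K.neighborFinset v = Finset.univ.erase v := by
      refine Finset.eq_of_subset_of_card_le (fun w hw => ?_) ?_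
      · simpa using ((K.mem_neighborFinset v w).1 hw).ne'
      · rw [Finset.card_erase_of_mem (Finset.mem_univ v), K.card_neighborFinset_eq_degree,
          Finset.card_univ]
        omega
    rw [← K.mem_neighborFinset, h1]
    simpa using hw
  have hmem : ∀ e, (e = e₁ ∨ e = e₂) ↔ e ∈ K.edgeSet ∧ v ∉ e := by
    intro e
    have : e ∈ K.edgeFinset \ K.incidenceFinset v ↔ e = e₁ ∨ e = e₂ := by rw [he]; simp
    rw [← this, Finset.mem_sdiff, mem_edgeFinset, mem_incidenceFinset, incidenceSet, Set.mem_sep_iff]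
    tauto
  induction e₁ with | h a b => ?_
  induction e₂ with | h c d => ?_
  have h1 := (hmem s(a, b)).1 (Or.inl rfl)
  have h2 := (hmem s(c, d)).1 (Or.inr rfl)
  simp only [mem_edgeSet, Sym2.mem_iff, not_or] at h1 h2
  refine ⟨a, b, c, d, h1.1.ne, h2.1.ne, Ne.symm h1.2.1, Ne.symm h1.2.2, Ne.symm h2.2.1,
    Ne.symm h2.2.2, hne, fun x y => ?_⟩
  rw [hmem, mem_edgeSet, Sym2.mem_iff]
  constructor
  · intro h
    have := h.ne
    tauto
  · rintro ⟨hxy, rfl | rfl | h⟩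
    · exact hdom y hxy.symm
    · exact (hdom x hxy).symm
    · exact h.1

/-- Two edges outside the star at a dominating vertex either meet, which gives `graphG1`, or are
disjoint, which gives `graphG2`. -/
theorem IsBicyclic.iso_of_dominating {n : ℕ} {K : SimpleGraph (Fin n)} (hK : IsBicyclic K)
    {v : Fin n} (hv : K.degree v + 1 = n) :
    Nonempty (K ≃g graphG1 n) ∨ Nonempty (K ≃g graphG2 n) := by
  obtain ⟨a, b, c, d, hab, hcd, hav, hbv, hcv, hdv, hne, hadj⟩ :=
    hK.exists_edges_of_dominating (v := v) (by rwa [Fintype.card_fin])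
  -- The case of a common endpoint `a`.
  have hshare : ∀ a b d : Fin n, a ≠ b → a ≠ d → b ≠ d → a ≠ v → b ≠ v → d ≠ v →
      (∀ x y, K.Adj x y ↔ x ≠ y ∧ (x = v ∨ y = v ∨ s(x, y) = s(a, b) ∨ s(x, y) = s(a, d))) →
      Nonempty (K ≃g graphG1 n) := by
    intro a b d hab had hbd hav hbv hdv hadj
    have hl : [v, a, b, d].Nodup := by
      simp [hab, had, hbd, hav.symm, hbv.symm, hdv.symm]
    obtain ⟨σ, hσ⟩ := hl.exists_perm_apply_eq
    have g0 : ∀ x, (σ x : ℕ) = 0 ↔ x = v := hσ 0 (by simp)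
    have g1 : ∀ x, (σ x : ℕ) = 1 ↔ x = a := hσ 1 (by simp)
    have g2 : ∀ x, (σ x : ℕ) = 2 ↔ x = b := hσ 2 (by simp)
    have g3 : ∀ x, (σ x : ℕ) = 3 ↔ x = d := hσ 3 (by simp)
    refine ⟨⟨σ, fun {x y} => ?_⟩⟩
    rw [graphG1_adj, hadj, Fin.val_ne_iff, σ.injective.ne_iff, Sym2.eq_iff, Sym2.eq_iff]
    simp only [g0, g1, g2, g3]
    tauto
  by_cases h1 : a = c
  · subst h1
    exact Or.inl (hshare a b d hab hcd (fun h => hne (by rw [h])) hav hbv hdv hadj)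
  by_cases h2 : a = d
  · subst h2
    rw [Sym2.eq_swap (a := c)] at hne
    exact Or.inl (hshare a b c hab h1 (fun h => hne (by rw [h])) hav hbv hcv
      (by simpa only [Sym2.eq_swap (a := c)] using hadj))
  by_cases h3 : b = c
  · subst h3
    exact Or.inl (hshare b a d hab.symm hcd h2 hbv hav hdv
      (by simpa only [Sym2.eq_swap (a := a) (b := b)] using hadj))
  by_cases h4 : b = d
  · subst h4
    exact Or.inl (hshare b a c hab.symm h3 h1 hbv hav hcv
      (by simpa only [Sym2.eq_swap (a := a) (b := b), Sym2.eq_swap (a := c) (b := b)] using hadj))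
  right
  have hl : [v, a, b, c, d].Nodup := by
    simp [hab, hcd, h1, h2, h3, h4, hav.symm, hbv.symm, hcv.symm, hdv.symm]
  obtain ⟨σ, hσ⟩ := hl.exists_perm_apply_eq
  have g0 : ∀ x, (σ x : ℕ) = 0 ↔ x = v := hσ 0 (by simp)
  have g1 : ∀ x, (σ x : ℕ) = 1 ↔ x = a := hσ 1 (by simp)
  have g2 : ∀ x, (σ x : ℕ) = 2 ↔ x = b := hσ 2 (by simp)
  have g3 : ∀ x, (σ x : ℕ) = 3 ↔ x = c := hσ 3 (by simp)
  have g4 : ∀ x, (σ x : ℕ) = 4 ↔ x = d := hσ 4 (by simp)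
  refine ⟨⟨σ, fun {x y} => ?_⟩⟩
  rw [graphG2_adj, hadj, Fin.val_ne_iff, σ.injective.ne_iff, Sym2.eq_iff, Sym2.eq_iff]
  simp only [g0, g1, g2, g3, g4]
  tauto

end DominatingVertex

/-! ### Reduction to numerical bounds -/

section Comparison

open SimpleGraph

theorem exists_quotient_root {C a s : ℝ} (hC : 0 ≤ C) (ha : 0 < a) (hs : 0 < s) (haC : a ≤ C) :
    ∃ c, s < c ∧ (c - s) * (c ^ 2 - C) = a * s := by
  have hcont : ContinuousOn (fun x : ℝ => (x - s) * (x ^ 2 - C)) (Set.Icc s (C + s + 1)) := by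
    fun_prop
  have hmem : a * s ∈ Set.Icc ((s - s) * (s ^ 2 - C))
      ((C + s + 1 - s) * ((C + s + 1) ^ 2 - C)) := by
    constructor
    · rw [sub_self, zero_mul]
      positivity
    · exact mul_le_mul (by linarith) (by nlinarith) hs.le (by linarith)
  obtain ⟨c, hc, hc'⟩ := intermediate_value_Icc (by linarith) hcont hmem
  refine ⟨c, lt_of_le_of_ne hc.1 ?_, hc'⟩
  rintro rfl
  simp only [sub_self, zero_mul] at hc'
  exact (mul_pos ha hs).ne hc'

/-- The value `c = ρ(A_f(G₂))` lies below `ρ(A_f(G₁))`. What decides the comparison is the convexity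
condition `2 q ^ 2 ≤ r ^ 2 + p ^ 2`. -/
theorem lt_weightedSpectralRadius_graphG1_of_root {f : ℝ → ℝ → ℝ} (hf : ∀ x y, f x y = f y x)
    {m : ℕ} {p q r s t c : ℝ} (hp : f (4 + m) 1 = p)
    (hq : f (4 + m) 2 = q) (hr : f (4 + m) 3 = r) (ht : f 3 2 = t) (hs0 : 0 < s) (hst : s ≤ t)
    (htq : t ≤ q) (hqr : q ≤ r) (hrq : r ≤ 2 * q) (hconv : 2 * q ^ 2 ≤ r ^ 2 + p ^ 2)
    (hsc : s < c) (hc : (c - s) * (c ^ 2 - (4 * q ^ 2 + m * p ^ 2)) = 4 * q ^ 2 * s) :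
    ENNReal.ofReal c < weightedSpectralRadius f (graphG1 (5 + m)) := by
  have hc0 : 0 < c := hs0.trans hsc
  have hcs : 0 < c - s := sub_pos.2 hsc
  have ht0 : 0 < t := hs0.trans_le hst
  have hq0 : 0 < q := ht0.trans_le htq
  have hE : 0 < c ^ 2 - 2 * t ^ 2 := by
    have h1 : 0 < c ^ 2 - (4 * q ^ 2 + m * p ^ 2) :=
      pos_of_mul_pos_right (by rw [hc]; positivity) hcs.le
    have h2 : 0 ≤ m * p ^ 2 := by positivity
    have h3 : t ^ 2 ≤ q ^ 2 := pow_le_pow_left₀ ht0.le htq 2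
    nlinarith
  have hE' := hE.ne'
  have hm : 5 + m = 4 + (m + 1) := by omega
  rw [hm]
  have hcast : (3 : ℝ) + ((m + 1 : ℕ) : ℝ) = 4 + m := by push_cast; ring
  -- The triangle coordinates solve the eigenvalue equations at the vertices of degree `3` and `2`.
  refine lt_weightedSpectralRadius_graphG1 hf (p := p) (q := q) (r := r) (t := t)
    (b := (r * c + 2 * t * q) / (c ^ 2 - 2 * t ^ 2)) (d := (q * c + t * r) / (c ^ 2 - 2 * t ^ 2))
    (by rw [hcast, hp]) (by rw [hcast, hq]) (by rw [hcast, hr]) ht hc0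
    (by rw [← mul_div_assoc, ← mul_div_assoc, div_eq_iff hE', add_mul, div_mul_cancel₀ _ hE']; ring)
    (by rw [← mul_div_assoc, ← mul_div_assoc, div_eq_iff hE', add_mul, div_mul_cancel₀ _ hE']; ring) ?_
  have hc' : c = 4 * q ^ 2 / (c - s) + m * p ^ 2 / c := by
    field_simp
    linarith
  have hkey : 0 < r * ((r * c + 2 * t * q) / (c ^ 2 - 2 * t ^ 2)) +
      2 * q * ((q * c + t * r) / (c ^ 2 - 2 * t ^ 2)) + p ^ 2 / c - 4 * q ^ 2 / (c - s) := by
    have e : r * ((r * c + 2 * t * q) / (c ^ 2 - 2 * t ^ 2)) +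
        2 * q * ((q * c + t * r) / (c ^ 2 - 2 * t ^ 2)) + p ^ 2 / c - 4 * q ^ 2 / (c - s) =
        (((r ^ 2 + 2 * q ^ 2) * c + 4 * t * r * q) * c * (c - s)
          - (4 * q ^ 2 * c - p ^ 2 * (c - s)) * (c ^ 2 - 2 * t ^ 2)) /
          (c * (c - s) * (c ^ 2 - 2 * t ^ 2)) := by
      field_simp
      ring
    rw [e]
    refine div_pos ?_ (by positivity)
    have h1 : (4 * q ^ 2 * c - p ^ 2 * (c - s)) * (c ^ 2 - 2 * t ^ 2) ≤
        (4 * q ^ 2 * c - (2 * q ^ 2 - r ^ 2) * (c - s)) * (c ^ 2 - 2 * t ^ 2) :=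
      mul_le_mul_of_nonneg_right (by nlinarith) hE.le
    -- Once `p ^ 2` is eliminated, the cubic terms in `c` cancel.
    have h2 : ((r ^ 2 + 2 * q ^ 2) * c + 4 * t * r * q) * c * (c - s)
        - (4 * q ^ 2 * c - (2 * q ^ 2 - r ^ 2) * (c - s)) * (c ^ 2 - 2 * t ^ 2) =
        4 * q * (t * r - q * s) * c ^ 2 + 4 * q * r * (t - s) * t * c +
        2 * t ^ 2 * (2 * q ^ 2 + r ^ 2 - 2 * q * r) * (c - s) +
        4 * t ^ 2 * s * q * (2 * q - r) := by ring
    have h3 : 0 ≤ 4 * q * (t * r - q * s) * c ^ 2 := by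
      have : q * s ≤ r * t := mul_le_mul hqr hst hs0.le (hq0.le.trans hqr)
      have : 0 ≤ t * r - q * s := by linarith
      positivity
    have h4 : 0 ≤ 4 * q * r * (t - s) * t * c := by
      have := sub_nonneg.2 hst
      have := hq0.trans_le hqr
      positivity
    have h5 : 0 < 2 * t ^ 2 * (2 * q ^ 2 + r ^ 2 - 2 * q * r) * (c - s) := by
      have : 0 < 2 * q ^ 2 + r ^ 2 - 2 * q * r := by nlinarith [sq_nonneg (q - r)]
      positivity
    have h6 : 0 ≤ 4 * t ^ 2 * s * q * (2 * q - r) := by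
      have := sub_nonneg.2 hrq
      positivity
    linarith
  have hsplit : ((m + 1 : ℕ) : ℝ) * p ^ 2 / c = m * p ^ 2 / c + p ^ 2 / c := by
    push_cast
    ring
  rw [hsplit]
  linarith

open Classical in
/-- Reduction of the ranking to numerical bounds: it is enough that every bicyclic graph without a
dominating vertex has spectral radius below `c`, where only two properties of `c = ρ(A_f(G₂))` are
needed. -/
theorem isSecondLargestBicyclic_iff_of_bounds {f : ℝ → ℝ → ℝ} (hf : ∀ x y, f x y = f y x)
    (hf0 : ∀ x y, 0 ≤ x → 0 ≤ y → 0 ≤ f x y) {m : ℕ} {p q r s t : ℝ} (hp : f (4 + m) 1 = p)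
    (hq : f (4 + m) 2 = q) (hr : f (4 + m) 3 = r) (hs : f 2 2 = s) (ht : f 3 2 = t) (hp0 : 0 < p)
    (hs0 : 0 < s) (hst : s ≤ t)
    (htq : t ≤ q) (hqr : q ≤ r) (hrq : r ≤ 2 * q) (hconv : 2 * q ^ 2 ≤ r ^ 2 + p ^ 2)
    (hK : ∀ c : ℝ, 0 < c → 4 * q ^ 2 + m * p ^ 2 < c ^ 2 →
      4 * q ^ 2 * s ≤ c * (c ^ 2 - (4 * q ^ 2 + m * p ^ 2)) →
      ∀ (K : SimpleGraph (Fin (5 + m))) (v : Fin (5 + m)) (D k : ℕ), IsBicyclic K →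
        K.degree v = D → (∀ w, K.degree w ≤ D) → 5 + m = D + k → 2 ≤ k →
        weightedSpectralRadius f K < ENNReal.ofReal c)
    (G : SimpleGraph (Fin (5 + m))) :
    IsSecondLargestBicyclic f G ↔ Nonempty (G ≃g graphG2 (5 + m)) := by
  have hq0 : 0 < q := (hs0.trans_le hst).trans_le htq
  obtain ⟨c, hsc, hc⟩ := exists_quotient_root (C := 4 * q ^ 2 + m * p ^ 2) (a := 4 * q ^ 2) (s := s)
    (by positivity) (by positivity) hs0 (le_add_of_nonneg_right (by positivity))
  have hc0 : 0 < c := hs0.trans hsc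
  have hcC : 0 < c ^ 2 - (4 * q ^ 2 + m * p ^ 2) :=
    pos_of_mul_pos_right (by rw [hc]; positivity) (sub_pos.2 hsc).le
  have h2 := weightedSpectralRadius_graphG2 hf hf0 hp hq hs hp0 hq0 hs0 hsc hc
  have h21 := lt_weightedSpectralRadius_graphG1_of_root hf hp hq hr ht hs0 hst htq hqr hrq hconv
    hsc hc
  rw [← h2] at h21
  have hb1 : IsBicyclic (graphG1 (5 + m)) := by
    rw [show 5 + m = 4 + (m + 1) by omega]
    exact isBicyclic_graphG1 (m + 1)
  have hother : ∀ K : SimpleGraph (Fin (5 + m)), IsBicyclic K → Nonempty (K ≃g graphG1 (5 + m)) ∨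
      Nonempty (K ≃g graphG2 (5 + m)) ∨
      weightedSpectralRadius f K < weightedSpectralRadius f (graphG2 (5 + m)) := by
    intro K hKb
    have : Nonempty (Fin (5 + m)) := ⟨⟨0, by omega⟩⟩
    obtain ⟨v, hv⟩ := K.exists_maximal_degree_vertex
    have hlt := K.degree_lt_card_verts v
    rw [Fintype.card_fin] at hlt
    by_cases hdom : K.degree v + 1 = 5 + m
    · rcases hKb.iso_of_dominating hdom with h | h
      exacts [Or.inl h, Or.inr (Or.inl h)]
    · refine Or.inr (Or.inr ?_)
      rw [h2]
      refine hK c hc0 (sub_pos.1 hcC) ?_ K v (K.degree v) (5 + m - K.degree v) hKb rfl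
        (fun w => hv ▸ K.degree_le_maxDegree w) (by omega) (by omega)
      nlinarith
  constructor
  · rintro ⟨hGb, H, hHb, hGH, hmax⟩
    rcases hother G hGb with ⟨⟨e⟩⟩ | h | h
    · -- The graph `graphG1` has the largest spectral radius of all, so that `H` cannot beat it.
      rw [weightedSpectralRadius_congr f e] at hGH
      rcases hother H hHb with ⟨⟨e'⟩⟩ | ⟨⟨e'⟩⟩ | h'
      · rw [weightedSpectralRadius_congr f e'] at hGH
        exact absurd hGH (lt_irrefl _)
      · rw [weightedSpectralRadius_congr f e'] at hGH
        exact absurd (hGH.trans h21) (lt_irrefl _)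
      · exact absurd ((hGH.trans h').trans h21) (lt_irrefl _)
    · exact h
    · -- Below `graphG2`, both `graphG1` and `graphG2` would have to be isomorphic to `H`.
      have hiso : ∀ K : SimpleGraph (Fin (5 + m)), IsBicyclic K →
          weightedSpectralRadius f G < weightedSpectralRadius f K → Nonempty (K ≃g H) :=
        fun K hKb hlt => by
          by_contra hno
          exact absurd (hlt.trans_le (hmax K hKb hno)) (lt_irrefl _)
      obtain ⟨e1⟩ := hiso _ hb1 (h.trans h21)
      obtain ⟨e2⟩ := hiso _ (isBicyclic_graphG2 m) h
      rw [weightedSpectralRadius_congr f e1, weightedSpectralRadius_congr f e2] at h21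
      exact absurd h21 (lt_irrefl _)
  · rintro ⟨e⟩
    have hGb : IsBicyclic G := by
      refine ⟨e.connected_iff.2 (isBicyclic_graphG2 m).1, ?_⟩
      rw [← (isBicyclic_graphG2 m).2, ← Nat.card_coe_set_eq, ← Nat.card_coe_set_eq]
      exact Nat.card_congr e.mapEdgeSet
    have hGe := weightedSpectralRadius_congr f e
    refine ⟨hGb, graphG1 (5 + m), hb1, hGe ▸ h21, fun K hKb hK1 => ?_⟩
    rcases hother K hKb with h | ⟨⟨e'⟩⟩ | h
    · exact absurd h hK1
    · rw [hGe, weightedSpectralRadius_congr f e']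
    · rw [hGe]
      exact h.le

end Comparison

/-! ### Polynomial inequalities -/

section Numerics

/-!
In each bound below, `n = D + k`, `C` is `4 q ^ 2 + (n - 5) p ^ 2` with `p` and `q` the weights of
the edges of `G₂` from the centre to a leaf and to a triangle vertex, `F` is a bound for half the
trace of the square, and the left-hand side is three times a bound for the sum of the weight
products of the (at most two) triangles. The factor in front of `C - F` is a number whose square is
at most `C`, and `16 * (n + 1) ^ 2` is `4 q ^ 2 s` with `s = 4` the weight of the edges of `G₂`
between two vertices of degree `2`. Graphs of small maximum degree are treated separately, since for
them the estimate of the edges away from a vertex of maximum degree is too weak.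
-/

/-- The spectral radius criterion for `c`, derived from the two known properties `C < c ^ 2` and
`S ≤ c * (c ^ 2 - C)` and a number `e` with `e ^ 2 ≤ C`. -/
theorem lt_mul_sq_sub_of_bounds {c C S F T e : ℝ} (hc : 0 < c) (hC : C < c ^ 2)
    (hS : S ≤ c * (c ^ 2 - C)) (heC : e ^ 2 ≤ C) (hF : F ≤ C)
    (h : T < S + e * (C - F)) : T < c * (c ^ 2 - F) := by
  have hec : e < c := lt_of_pow_lt_pow_left₀ 2 hc.le (heC.trans_lt hC)
  nlinarith [mul_le_mul_of_nonneg_right hec.le (sub_nonneg.2 hF)]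

/-- A parametrization by natural numbers in which the differences of the polynomials below have
nonnegative coefficients. -/
theorem exists_param_of_ten_le {D k : ℕ} (hk : 2 ≤ k) (hn : 10 ≤ D + k) (hD : k + 4 ≤ 2 * D) :
    (∃ u : ℕ, k = 2 ∧ D = 8 + u) ∨
    (∃ u : ℕ, k = 3 ∧ D = 7 + u) ∨
    (∃ u : ℕ, k = 4 ∧ D = 6 + u) ∨
    (∃ u : ℕ, k = 5 ∧ D = 5 + u) ∨
    ∃ u w : ℕ, k = 6 + u ∧ 2 * D = 10 + u + w := by
  by_cases hk' : 6 ≤ k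
  · exact Or.inr (Or.inr (Or.inr (Or.inr (⟨k - 6, 2 * D - k - 4, by omega, by omega⟩))))
  · interval_cases k
    · exact Or.inl ⟨D - 8, by omega, by omega⟩
    · exact Or.inr (Or.inl ⟨D - 7, by omega, by omega⟩)
    · exact Or.inr (Or.inr (Or.inl ⟨D - 6, by omega, by omega⟩))
    · exact Or.inr (Or.inr (Or.inr (Or.inl ⟨D - 5, by omega, by omega⟩)))

theorem firstZagreb_bound_of_large_degree {D k : ℕ} (hk : 2 ≤ k) (hn : 10 ≤ D + k)
    (hD : k + 4 ≤ 2 * D) {n F C : ℝ} (hnr : n = D + k)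
    (hF : F = D * (D + 1) ^ 2 + (k + 3) * (2 * D + k + 3) + (k + 1) * (k + 4) ^ 2)
    (hC : C = 4 * (n + 1) ^ 2 + (n - 5) * n ^ 2) :
    F ≤ C ∧ 6 * (((2 * D + k + 4) / 2) ^ 2 * (k + 4)) <
      16 * (n + 1) ^ 2 + 3 * n * (C - F) := by
  subst hF hC hnr
  rw [← sub_nonneg, ← sub_pos (b := 6 * _)]
  rcases exists_param_of_ten_le hk hn hD with
    ⟨u, rfl, rfl⟩ | ⟨u, rfl, rfl⟩ | ⟨u, rfl, rfl⟩ | ⟨u, rfl, rfl⟩ | ⟨u, w, rfl, h⟩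
  · push_cast
    constructor <;> ring_nf <;> positivity
  · push_cast
    constructor <;> ring_nf <;> positivity
  · push_cast
    constructor <;> ring_nf <;> positivity
  · push_cast
    constructor <;> ring_nf <;> positivity
  · have h' : (D : ℝ) = (10 + u + w) / 2 := by
      have : ((2 * D : ℕ) : ℝ) = ((10 + u + w : ℕ) : ℝ) := by rw [h]
      push_cast at this
      linarith
    rw [h']
    push_cast
    constructor <;> ring_nf <;> positivity

theorem firstZagreb_bound_of_small_degree {n : ℝ} (hn : 10 ≤ n) {C : ℝ}
    (hC : C = 4 * (n + 1) ^ 2 + (n - 5) * n ^ 2) :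
    (3 * n) ^ 2 ≤ C ∧ (n + 1) * (2 * (n + 3) / 3) ^ 2 ≤ C ∧
      6 * (2 * (n + 3) / 3) ^ 3 < 16 * (n + 1) ^ 2 + 3 * n * (C - (n + 1) * (2 * (n + 3) / 3) ^ 2) := by
  obtain ⟨u, hu, rfl⟩ : ∃ u : ℝ, 0 ≤ u ∧ n = 10 + u := ⟨n - 10, by linarith, by ring⟩
  subst hC
  rw [← sub_nonneg, ← sub_nonneg (b := _ * _), ← sub_pos (b := 6 * _)]
  refine ⟨?_, ?_, ?_⟩ <;> ring_nf <;> positivity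

/-- A parametrization by natural numbers in which the differences of the polynomials below have
nonnegative coefficients. -/
theorem exists_param_of_nine_le {D k : ℕ} (hk : 2 ≤ k) (hn : 9 ≤ D + k) (hD : k + 4 ≤ 2 * D) :
    (∃ u : ℕ, k = 2 ∧ D = 7 + u) ∨
    (∃ u : ℕ, k = 3 ∧ D = 6 + u) ∨
    (∃ u : ℕ, k = 4 ∧ D = 5 + u) ∨
    ∃ u w : ℕ, k = 5 + u ∧ 2 * D = 9 + u + w := by
  by_cases hk' : 5 ≤ k
  · exact Or.inr (Or.inr (Or.inr (⟨k - 5, 2 * D - k - 4, by omega, by omega⟩)))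
  · interval_cases k
    · exact Or.inl ⟨D - 7, by omega, by omega⟩
    · exact Or.inr (Or.inl ⟨D - 6, by omega, by omega⟩)
    · exact Or.inr (Or.inr (Or.inl ⟨D - 5, by omega, by omega⟩))

theorem hyperZagreb_bound_of_large_degree {D k : ℕ} (hk : 2 ≤ k) (hn : 9 ≤ D + k)
    (hD : k + 4 ≤ 2 * D) {n F C : ℝ} (hnr : n = D + k)
    (hF : F = D * (D + 1) ^ 4 + (k + 3) * ((2 * D + k + 3) * ((D + k + 2) ^ 2 + (D + 1) ^ 2))
      + (k + 1) * ((k + 4) ^ 2) ^ 2)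
    (hC : C = 4 * (n + 1) ^ 4 + (n - 5) * n ^ 4) :
    F ≤ C ∧ 6 * (((2 * D + k + 4) / 2) ^ 4 * (k + 4) ^ 2) < 3 * n ^ 2 * (C - F) := by
  subst hF hC hnr
  rw [← sub_nonneg, ← sub_pos (b := 6 * _)]
  rcases exists_param_of_nine_le hk hn hD with
    ⟨u, rfl, rfl⟩ | ⟨u, rfl, rfl⟩ | ⟨u, rfl, rfl⟩ | ⟨u, w, rfl, h⟩
  · push_cast
    constructor <;> ring_nf <;> positivity
  · push_cast
    constructor <;> ring_nf <;> positivity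
  · push_cast
    constructor <;> ring_nf <;> positivity
  · have h' : (D : ℝ) = (9 + u + w) / 2 := by
      have : ((2 * D : ℕ) : ℝ) = ((9 + u + w : ℕ) : ℝ) := by rw [h]
      push_cast at this
      linarith
    rw [h']
    push_cast
    constructor <;> ring_nf <;> positivity

theorem hyperZagreb_bound_of_small_degree {n : ℝ} (hn : 9 ≤ n) {C : ℝ}
    (hC : C = 4 * (n + 1) ^ 4 + (n - 5) * n ^ 4) :
    (3 * n ^ 2) ^ 2 ≤ C ∧ (n + 1) * ((2 * (n + 3) / 3) ^ 2) ^ 2 ≤ C ∧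
      6 * ((2 * (n + 3) / 3) ^ 2) ^ 3 < 3 * n ^ 2 * (C - (n + 1) * ((2 * (n + 3) / 3) ^ 2) ^ 2) := by
  obtain ⟨u, hu, rfl⟩ : ∃ u : ℝ, 0 ≤ u ∧ n = 9 + u := ⟨n - 9, by linarith, by ring⟩
  subst hC
  rw [← sub_nonneg, ← sub_nonneg (b := _ * _), ← sub_pos (b := 6 * _)]
  refine ⟨?_, ?_, ?_⟩ <;> ring_nf <;> positivity

/-- A parametrization by natural numbers in which the differences of the polynomials below have
nonnegative coefficients. -/
theorem exists_param_of_eight_le {D k : ℕ} (hk : 2 ≤ k) (hn : 8 ≤ D + k) (hD : k + 1 ≤ D) :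
    (∃ u : ℕ, k = 2 ∧ D = 6 + u) ∨
    (∃ u : ℕ, k = 3 ∧ D = 5 + u) ∨
    ∃ u w : ℕ, k = 4 + u ∧ D = 5 + u + w := by
  by_cases hk' : 4 ≤ k
  · exact Or.inr (Or.inr (⟨k - 4, D - k - 1, by omega, by omega⟩))
  · interval_cases k
    · exact Or.inl ⟨D - 6, by omega, by omega⟩
    · exact Or.inr (Or.inl ⟨D - 5, by omega, by omega⟩)

theorem forgotten_bound_of_large_degree {D k : ℕ} (hk : 2 ≤ k) (hn : 8 ≤ D + k)
    (hD : k + 1 ≤ D) {n F C : ℝ} (hnr : n = D + k)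
    (hF : F = D * (D ^ 2 + 1) ^ 2 + (k + 3) * ((k + 3) * (2 * D ^ 2 + (k + 2) ^ 2 + 1))
      + (k + 1) * ((k + 3) ^ 2 + 1) ^ 2)
    (hC : C = 4 * ((n - 1) ^ 2 + 4) ^ 2 + (n - 5) * ((n - 1) ^ 2 + 1) ^ 2) :
    F ≤ C ∧ 6 * ((D ^ 2 + (k + 2) ^ 2) ^ 2 * ((k + 3) ^ 2 + 1)) <
      2 * (n - 1) ^ 2 * (C - F) := by
  subst hF hC hnr
  rw [← sub_nonneg, ← sub_pos (b := 6 * _)]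
  rcases exists_param_of_eight_le hk hn hD with
    ⟨u, rfl, rfl⟩ | ⟨u, rfl, rfl⟩ | ⟨u, w, rfl, rfl⟩
  · push_cast
    constructor <;> ring_nf <;> positivity
  · push_cast
    constructor <;> ring_nf <;> positivity
  · push_cast
    constructor <;> ring_nf <;> positivity

theorem forgotten_bound_of_small_degree {n : ℝ} (hn : 8 ≤ n) {C : ℝ}
    (hC : C = 4 * ((n - 1) ^ 2 + 4) ^ 2 + (n - 5) * ((n - 1) ^ 2 + 1) ^ 2) :
    (2 * (n - 1) ^ 2) ^ 2 ≤ C ∧ (n + 1) * (n ^ 2 / 2) ^ 2 ≤ C ∧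
      6 * (n ^ 2 / 2) ^ 3 < 2 * (n - 1) ^ 2 * (C - (n + 1) * (n ^ 2 / 2) ^ 2) := by
  obtain ⟨u, hu, rfl⟩ : ∃ u : ℝ, 0 ≤ u ∧ n = 8 + u := ⟨n - 8, by linarith, by ring⟩
  subst hC
  rw [← sub_nonneg, ← sub_nonneg (b := _ * _), ← sub_pos (b := 6 * _)]
  refine ⟨?_, ?_, ?_⟩ <;> ring_nf <;> positivity

end Numerics

/-! ### The three indices -/

section Indices

open scoped Classical

theorem isSecondLargestBicyclic_add_iff {m : ℕ} (hm : 5 ≤ m) (G : SimpleGraph (Fin (5 + m))) :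
    IsSecondLargestBicyclic (fun x y => x + y) G ↔ Nonempty (G ≃g graphG2 (5 + m)) := by
  have hmr : (5 : ℝ) ≤ m := by exact_mod_cast hm
  have hf : ∀ x y : ℝ, x + y = y + x := add_comm
  have hf0 : ∀ x y : ℝ, 0 ≤ x → 0 ≤ y → 0 ≤ x + y := fun _ _ => add_nonneg
  refine isSecondLargestBicyclic_iff_of_bounds (p := 5 + m) (q := 6 + m) (r := 7 + m) (s := 4)
    (t := 5) hf hf0 (by ring) (by ring) (by ring) (by norm_num) (by norm_num) (by positivity)
    (by norm_num) (by norm_num) (by linarith) (by linarith) (by linarith) (by nlinarith) ?_ G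
  intro c hc0 hcC hcS K v D k hK hv hmax hDk hk
  have hcard : Fintype.card (Fin (5 + m)) = D + k := by rw [Fintype.card_fin, hDk]
  have hDkr : (5 : ℝ) + m = D + k := by exact_mod_cast hDk
  by_cases hlarge : k + 4 ≤ 2 * D
  · have hlr : (k : ℝ) + 4 ≤ 2 * D := by exact_mod_cast hlarge
    obtain ⟨hF, hlt⟩ := firstZagreb_bound_of_large_degree (n := 5 + m)
      (C := 4 * (6 + m) ^ 2 + m * (5 + m) ^ 2) hk (by omega) hlarge hDkr rfl (by ring)
    have heC := (firstZagreb_bound_of_small_degree (n := 5 + m)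
      (C := 4 * (6 + m) ^ 2 + m * (5 + m) ^ 2) (by linarith) (by ring)).1
    refine hK.weightedSpectralRadius_lt_of_degree hf hf0 hv hcard (p := ((D : ℝ) + 1) ^ 2)
      (σ := 2 * D + k + 3) (w := k + 4) (m := ((2 * D + k + 4) / 2) ^ 2) (by positivity)
      ?_ ?_ ?_ (by positivity) ?_ hc0
      (lt_mul_sq_sub_of_bounds hc0 hcC hcS heC hF (hlt.trans_eq (by ring)))
    · intro d hd1 hd2
      have hd1r : (1 : ℝ) ≤ d := by exact_mod_cast hd1
      have hd2r : (d : ℝ) ≤ k + 2 := by exact_mod_cast hd2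
      nlinarith [mul_nonneg (sub_nonneg.2 hd1r) (sub_nonneg.2 hd2r)]
    · intro a b _ _ hab
      exact_mod_cast hab
    · intro a b _ _ _ _ hab
      have habr : (a : ℝ) + b ≤ k + 4 := by exact_mod_cast hab
      have h1 : (D + a : ℝ) * (D + b) ≤ ((2 * D + (a + b)) / 2) ^ 2 := by
        nlinarith [sq_nonneg ((a : ℝ) - b)]
      refine h1.trans (pow_le_pow_left₀ (by positivity) (by linarith) 2)
    · exact pow_le_pow_left₀ (by positivity) (by linarith) 2
  · have hsr : 2 * (D : ℝ) ≤ k + 3 := by exact_mod_cast (by omega : 2 * D ≤ k + 3)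
    obtain ⟨heC, hF, hlt⟩ := firstZagreb_bound_of_small_degree (n := 5 + m)
      (C := 4 * (6 + m) ^ 2 + m * (5 + m) ^ 2) (by linarith) (by ring)
    refine hK.weightedSpectralRadius_lt_of_weight hf hf0 (w := 2 * (5 + m + 3) / 3) ?_
      (by positivity) hc0 ?_
    · intro i j
      have hi : (K.degree i : ℝ) ≤ D := by exact_mod_cast hmax i
      have hj : (K.degree j : ℝ) ≤ D := by exact_mod_cast hmax j
      linarith
    · rw [Fintype.card_fin]
      push_cast
      exact lt_mul_sq_sub_of_bounds hc0 hcC hcS heC hF (hlt.trans_eq (by ring))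

theorem isSecondLargestBicyclic_add_sq_iff {m : ℕ} (hm : 4 ≤ m) (G : SimpleGraph (Fin (5 + m))) :
    IsSecondLargestBicyclic (fun x y => (x + y) ^ 2) G ↔ Nonempty (G ≃g graphG2 (5 + m)) := by
  have hmr : (4 : ℝ) ≤ m := by exact_mod_cast hm
  have hf : ∀ x y : ℝ, (x + y) ^ 2 = (y + x) ^ 2 := fun x y => by rw [add_comm]
  have hf0 : ∀ x y : ℝ, 0 ≤ x → 0 ≤ y → 0 ≤ (x + y) ^ 2 := fun _ _ _ _ => sq_nonneg _
  refine isSecondLargestBicyclic_iff_of_bounds (p := (5 + m) ^ 2) (q := (6 + m) ^ 2)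
    (r := (7 + m) ^ 2) (s := 16) (t := 25) hf hf0 (by ring) (by ring) (by ring) (by norm_num)
    (by norm_num) (by positivity) (by norm_num) (by norm_num) (by nlinarith) (by nlinarith)
    (by nlinarith) ?_ ?_ G
  · rw [← sub_nonneg]
    ring_nf
    positivity
  intro c hc0 hcC hcS K v D k hK hv hmax hDk hk
  have hcS' : 0 ≤ c * (c ^ 2 - (4 * ((6 + m : ℝ) ^ 2) ^ 2 + m * ((5 + m) ^ 2) ^ 2)) :=
    le_trans (by positivity) hcS
  have hcard : Fintype.card (Fin (5 + m)) = D + k := by rw [Fintype.card_fin, hDk]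
  have hDkr : (5 : ℝ) + m = D + k := by exact_mod_cast hDk
  by_cases hlarge : k + 4 ≤ 2 * D
  · have hlr : (k : ℝ) + 4 ≤ 2 * D := by exact_mod_cast hlarge
    obtain ⟨hF, hlt⟩ := hyperZagreb_bound_of_large_degree (n := 5 + m)
      (C := 4 * ((6 + m) ^ 2) ^ 2 + m * ((5 + m) ^ 2) ^ 2) hk (by omega) hlarge hDkr rfl (by ring)
    have heC := (hyperZagreb_bound_of_small_degree (n := 5 + m)
      (C := 4 * ((6 + m) ^ 2) ^ 2 + m * ((5 + m) ^ 2) ^ 2) (by linarith) (by ring)).1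
    refine hK.weightedSpectralRadius_lt_of_degree hf hf0 hv hcard (p := ((D : ℝ) + 1) ^ 4)
      (σ := (2 * D + k + 3) * ((D + k + 2) ^ 2 + (D + 1) ^ 2)) (w := (k + 4) ^ 2)
      (m := ((2 * D + k + 4) / 2) ^ 4) (by positivity)
      ?_ ?_ ?_ (by positivity) ?_ hc0
      (lt_mul_sq_sub_of_bounds hc0 hcC hcS' heC hF (hlt.trans_eq (by ring)))
    · intro d hd1 hd2
      have hd1r : (1 : ℝ) ≤ d := by exact_mod_cast hd1
      have hd2r : (d : ℝ) ≤ k + 2 := by exact_mod_cast hd2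
      have h1 : (2 * D + d + 1 : ℝ) * ((D + d) ^ 2 + (D + 1) ^ 2) ≤
          (2 * D + k + 3) * ((D + k + 2) ^ 2 + (D + 1) ^ 2) :=
        mul_le_mul (by linarith)
          (add_le_add (pow_le_pow_left₀ (by positivity) (by linarith) 2) le_rfl)
          (by positivity) (by positivity)
      have h2 := mul_le_mul_of_nonneg_left h1 (sub_nonneg.2 hd1r)
      refine le_of_eq_of_le ?_ (add_le_add_right h2 _)
      ring
    · intro a b _ _ hab
      have habr : (a : ℝ) + b ≤ k + 4 := by exact_mod_cast hab
      exact pow_le_pow_left₀ (by positivity) habr 2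
    · intro a b _ _ _ _ hab
      have habr : (a : ℝ) + b ≤ k + 4 := by exact_mod_cast hab
      have h1 : (D + a : ℝ) * (D + b) ≤ ((2 * D + (a + b)) / 2) ^ 2 := by
        nlinarith [sq_nonneg ((a : ℝ) - b)]
      have h2 : (D + a : ℝ) * (D + b) ≤ ((2 * D + k + 4) / 2) ^ 2 :=
        h1.trans (pow_le_pow_left₀ (by positivity) (by linarith) 2)
      refine le_of_eq_of_le ?_ ((pow_le_pow_left₀ (by positivity) h2 2).trans_eq ?_) <;> ring
    · rw [← pow_mul]
      exact pow_le_pow_left₀ (by positivity) (by linarith) 4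
  · have hsr : 2 * (D : ℝ) ≤ k + 3 := by exact_mod_cast (by omega : 2 * D ≤ k + 3)
    obtain ⟨heC, hF, hlt⟩ := hyperZagreb_bound_of_small_degree (n := 5 + m)
      (C := 4 * ((6 + m) ^ 2) ^ 2 + m * ((5 + m) ^ 2) ^ 2) (by linarith) (by ring)
    refine hK.weightedSpectralRadius_lt_of_weight hf hf0 (w := (2 * (5 + m + 3) / 3) ^ 2) ?_
      (by positivity) hc0 ?_
    · intro i j
      have hi : (K.degree i : ℝ) ≤ D := by exact_mod_cast hmax i
      have hj : (K.degree j : ℝ) ≤ D := by exact_mod_cast hmax j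
      exact pow_le_pow_left₀ (by positivity) (by linarith) 2
    · rw [Fintype.card_fin]
      push_cast
      exact lt_mul_sq_sub_of_bounds hc0 hcC hcS' heC hF (hlt.trans_eq (by ring))

theorem isSecondLargestBicyclic_sq_add_sq_iff {m : ℕ} (hm : 3 ≤ m)
    (G : SimpleGraph (Fin (5 + m))) :
    IsSecondLargestBicyclic (fun x y => x ^ 2 + y ^ 2) G ↔ Nonempty (G ≃g graphG2 (5 + m)) := by
  have hmr : (3 : ℝ) ≤ m := by exact_mod_cast hm
  have hf : ∀ x y : ℝ, x ^ 2 + y ^ 2 = y ^ 2 + x ^ 2 := fun x y => add_comm _ _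
  have hf0 : ∀ x y : ℝ, 0 ≤ x → 0 ≤ y → 0 ≤ x ^ 2 + y ^ 2 := fun _ _ _ _ => by positivity
  refine isSecondLargestBicyclic_iff_of_bounds (p := (4 + m) ^ 2 + 1) (q := (4 + m) ^ 2 + 4)
    (r := (4 + m) ^ 2 + 9) (s := 8) (t := 13) hf hf0 (by ring) (by ring) (by ring) (by norm_num)
    (by norm_num) (by positivity) (by norm_num) (by norm_num) (by nlinarith) (by nlinarith)
    (by nlinarith) (by nlinarith) ?_ G
  intro c hc0 hcC hcS K v D k hK hv hmax hDk hk
  have hcS' : 0 ≤ c * (c ^ 2 - (4 * ((4 + m : ℝ) ^ 2 + 4) ^ 2 + m * ((4 + m) ^ 2 + 1) ^ 2)) :=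
    le_trans (by positivity) hcS
  have hcard : Fintype.card (Fin (5 + m)) = D + k := by rw [Fintype.card_fin, hDk]
  have hDkr : (5 : ℝ) + m = D + k := by exact_mod_cast hDk
  by_cases hlarge : k + 1 ≤ D
  · have hlr : (k : ℝ) + 1 ≤ D := by exact_mod_cast hlarge
    obtain ⟨hF, hlt⟩ := forgotten_bound_of_large_degree (n := 5 + m)
      (C := 4 * ((4 + m) ^ 2 + 4) ^ 2 + m * ((4 + m) ^ 2 + 1) ^ 2) hk (by omega) hlarge hDkr rfl
      (by ring)
    have heC := (forgotten_bound_of_small_degree (n := 5 + m)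
      (C := 4 * ((4 + m) ^ 2 + 4) ^ 2 + m * ((4 + m) ^ 2 + 1) ^ 2) (by linarith) (by ring)).1
    refine hK.weightedSpectralRadius_lt_of_degree hf hf0 hv hcard (p := ((D : ℝ) ^ 2 + 1) ^ 2)
      (σ := (k + 3) * (2 * D ^ 2 + (k + 2) ^ 2 + 1)) (w := (k + 3) ^ 2 + 1)
      (m := (D ^ 2 + (k + 2) ^ 2) ^ 2) (by positivity)
      ?_ ?_ ?_ (by positivity) ?_ hc0
      (lt_mul_sq_sub_of_bounds hc0 hcC hcS' heC hF (hlt.trans_eq (by ring)))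
    · intro d hd1 hd2
      have hd1r : (1 : ℝ) ≤ d := by exact_mod_cast hd1
      have hd2r : (d : ℝ) ≤ k + 2 := by exact_mod_cast hd2
      have h1 : (d + 1 : ℝ) * (2 * D ^ 2 + d ^ 2 + 1) ≤
          (k + 3) * (2 * D ^ 2 + (k + 2) ^ 2 + 1) :=
        mul_le_mul (by linarith) (add_le_add (add_le_add le_rfl
          (pow_le_pow_left₀ (by positivity) hd2r 2)) le_rfl) (by positivity) (by positivity)
      have h2 := mul_le_mul_of_nonneg_left h1 (sub_nonneg.2 hd1r)
      refine le_of_eq_of_le ?_ (add_le_add_right h2 _)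
      ring
    · intro a b ha hb hab
      have har : (1 : ℝ) ≤ a := by exact_mod_cast ha
      have hbr : (1 : ℝ) ≤ b := by exact_mod_cast hb
      have habr : (a : ℝ) + b ≤ k + 4 := by exact_mod_cast hab
      -- Here `a * b ≥ a + b - 1`, so that `a ^ 2 + b ^ 2 ≤ (a + b - 1) ^ 2 + 1`.
      have h1 : (a + b - 1 : ℝ) ^ 2 ≤ (k + 3) ^ 2 :=
        pow_le_pow_left₀ (by linarith) (by linarith) 2
      nlinarith [mul_nonneg (sub_nonneg.2 har) (sub_nonneg.2 hbr)]
    · intro a b _ _ ha hb _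
      have har : (a : ℝ) ≤ k + 2 := by exact_mod_cast ha
      have hbr : (b : ℝ) ≤ k + 2 := by exact_mod_cast hb
      rw [sq ((D : ℝ) ^ 2 + (k + 2) ^ 2)]
      exact mul_le_mul (add_le_add le_rfl (pow_le_pow_left₀ (by positivity) har 2))
        (add_le_add le_rfl (pow_le_pow_left₀ (by positivity) hbr 2)) (by positivity)
        (by positivity)
    · refine pow_le_pow_left₀ (by positivity) ?_ 2
      have h6 : 8 ≤ D + k := by omega
      have h6r : (8 : ℝ) ≤ D + k := by exact_mod_cast h6
      nlinarith
  · have hsr : (D : ℝ) ≤ k := by exact_mod_cast (by omega : D ≤ k)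
    obtain ⟨heC, hF, hlt⟩ := forgotten_bound_of_small_degree (n := 5 + m)
      (C := 4 * ((4 + m) ^ 2 + 4) ^ 2 + m * ((4 + m) ^ 2 + 1) ^ 2) (by linarith) (by ring)
    refine hK.weightedSpectralRadius_lt_of_weight hf hf0 (w := (5 + m) ^ 2 / 2) ?_
      (by positivity) hc0 ?_
    · intro i j
      have hi : (K.degree i : ℝ) ≤ (5 + m) / 2 := by
        have : (K.degree i : ℝ) ≤ D := by exact_mod_cast hmax i
        linarith
      have hj : (K.degree j : ℝ) ≤ (5 + m) / 2 := by
        have : (K.degree j : ℝ) ≤ D := by exact_mod_cast hmax j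
        linarith
      have hi2 := pow_le_pow_left₀ (by positivity) hi 2
      have hj2 := pow_le_pow_left₀ (by positivity) hj 2
      linarith
    · rw [Fintype.card_fin]
      push_cast
      exact lt_mul_sq_sub_of_bounds hc0 hcC hcS' heC hF (hlt.trans_eq (by ring))

end Indices

theorem theorem3p2 (n : ℕ) :
    (10 ≤ n → ∀ G : SimpleGraph (Fin n),
      IsSecondLargestBicyclic (fun x y => x + y) G ↔ Nonempty (G ≃g graphG2 n)) ∧
    (9 ≤ n → ∀ G : SimpleGraph (Fin n),
      IsSecondLargestBicyclic (fun x y => (x + y) ^ 2) G ↔ Nonempty (G ≃g graphG2 n)) ∧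
    (8 ≤ n → ∀ G : SimpleGraph (Fin n),
      IsSecondLargestBicyclic (fun x y => x ^ 2 + y ^ 2) G ↔ Nonempty (G ≃g graphG2 n)) := by
  refine ⟨fun hn => ?_, fun hn => ?_, fun hn => ?_⟩
  all_goals obtain ⟨m, rfl⟩ := Nat.exists_eq_add_of_le (show 5 ≤ n by omega)
  · exact isSecondLargestBicyclic_add_iff (by omega)
  · exact isSecondLargestBicyclic_add_sq_iff (by omega)
  · exact isSecondLargestBicyclic_sq_add_sq_iff (by omega)
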